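/- **Conventions.** Let $\mathbb D$ be the closed Euclidean unit ball of the space at hand ($\mathbb R^n$ or $\mathbb R^{2n}$), and let $A_*=A\setminus\{0\}$. We write $X\sim L^n(\mu,\Sigma,\mathcal X)$ if $X=(X(t))_{t\ge0}$ is an $n$-dimensional Lévy process (a.s. càdlàg paths, $X(0)=0$ a.s., independent stationary increments) with $\mathbb E\,e^{i\langle\theta,X(t)\rangle}=e^{t\Psi(\theta)}$ and $$\Psi(\theta)=i\langle\mu,\theta\rangle-\tfrac12\theta\Sigma\theta'+\int_{\mathbb R^n_*}\bigl(e^{i\langle\theta,x\rangle}-1-i\langle\theta,x\rangle\mathbf 1_{\mathbb D}(x)\bigr)\,\mathcal X(dx),$$ where $\mu\in\mathbb R^n$, $\Sigma$ is a covariance matrix and $\int_{\mathbb R^n_*}(\|x\|^2\wedge1)\,\mathcal X(dx)<\infty$. We write $T\sim S^n(d,\mathcal T)$ if $T$ is a Lévy process with nondecreasing components, Lévy measure $\mathcal T$ (so that $T$ has Gaussian covariance $0$ and $\int_{\mathbb D_*}\|t\|\,\mathcal T(dt)<\infty$) and drift $d=\gamma-\int_{\mathbb D_*}t\,\mathcal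 T(dt)\in[0,\infty)^n$, where $\gamma$ is the location vector in its triplet $(\gamma,0,\mathcal T)$. For $t=(t_1,\dots,t_n)\in[0,\infty)^n$ put $X(t)=(X_1(t_1),\dots,X_n(t_n))$. Order the coordinates as $t_{(1)}\le\dots\le t_{(n)}$, put $t_{(0)}=0$, $\Delta t_{(k)}=t_{(k)}-t_{(k-1)}$ and $J_k=\{(k),\dots,(n)\}$, and let $\pi_J$ be the coordinate projection $\pi_J(x)=\sum_{j\in J}x_je_j$ and $\mathcal X_J$ the restriction to $\mathbb R^n_*$ of the image of $\mathcal X$ under $\pi_J$. Define $$t\diamond\mu=(t_k\mu_k)_k,\qquad (t\diamond\Sigma)_{kl}=\Sigma_{kl}(t_k\wedge t_l),\qquad t\diamond\mathcal X=\sum_{k=1}^n\Delta t_{(k)}\,\mathcal X_{J_k},$$ $$c(t,\mathcal X)=\sum_{k=2}^n\Delta t_{(k)}\int_{\mathbb D^C}\pi_{J_k}(x)\,\mathbf 1_{\mathbb D}(\pi_{J_k}(x))\,\mathcal X(dx).$$ Let $X\sim L^n(\mu,\Sigma,\mathcal X)$ and $T\sim S^n(d,\mathcal T)$. We say that $Z\overset{d}{=}(T,X\odot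 T)$ *in the weak sense* if $Z$ (possibly defined on another probability space) is a $2n$-dimensional Lévy process $Z\sim L^{2n}((m_1,m_2),\Theta,\mathcal Z)$ with $$m_1=d+\int_{[0,\infty)^n_*}t\,\mathbb P\bigl((t,X(t))\in\mathbb D\bigr)\,\mathcal T(dt),$$ $$m_2=c(d,\mathcal X)+d\diamond\mu+\int_{[0,\infty)^n_*}\mathbb E\bigl[X(t)\mathbf 1_{\mathbb D}(t,X(t))\bigr]\,\mathcal T(dt),$$ $$\Theta=\begin{pmatrix}0&0\\0&d\diamond\Sigma\end{pmatrix},\qquad \mathcal Z(dt,dx)=\bigl(\delta_0\otimes(d\diamond\mathcal X)\bigr)(dt,dx)+\mathbf 1_{[0,\infty)^n_*\times\mathbb R^n}(t,x)\,\mathbb P(X(t)\in dx)\,\mathcal T(dt).$$ **Proposition.** Let $X\sim L^n(\mu,\Sigma,\mathcal X)$ and $T\sim S^n(d,\mathcal T)$ be independent processes on a common probability space, and let $Z\overset{d}{=}(T,X\odot T)$ in the weak sense. If $T$ has monotone components, that is, almost surely $T_1(t)\le T_2(t)\le\dots\le T_n(t)$ for all $t\ge0$, then for every fixed $t\ge0$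 $$Z(t)\overset{d}{=}\bigl(T(t),X(T(t))\bigr),$$ where $X(T(t))=(X_1(T_1(t)),\dots,X_n(T_n(t)))$. -/

import Mathlib

open MeasureTheory ProbabilityTheory Filter Topology
open scoped NNReal ENNReal

noncomputable section

namespace WeakSubordination

section Levy

variable {ι : Type*} [Fintype ι] {Ω : Type*} [MeasurableSpace Ω]

/-- A path indexed by `[0, ∞)` is càdlàg: right-continuous with left limits. -/
def IsCadlag (f : ℝ≥0 → EuclideanSpace ℝ ι) : Prop :=
  (∀ t, ContinuousWithinAt f (Set.Ici t) t) ∧ ∀ t, ∃ l, Tendsto f (𝓝[<] t) (𝓝 l)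

/-- Lévy processes: started at zero, with independent and stationary increments, stochastically
continuous, with almost surely càdlàg paths. -/
structure IsLevyProcess (X : ℝ≥0 → Ω → EuclideanSpace ℝ ι) (P : Measure Ω) : Prop where
  measurable : ∀ t, Measurable (X t)
  zero : ∀ᵐ ω ∂P, X 0 ω = 0
  indep : HasIndepIncrements X P
  stationary : ∀ s t, IdentDistrib (fun ω => X (s + t) ω - X s ω) (X t) P P
  stochCont : ∀ t, TendstoInMeasure P X (𝓝 t) (X t)
  cadlag : ∀ᵐ ω ∂P, IsCadlag (fun t => X t ω)

/-- Lévy measures. A Borel measure on the punctured space is encoded as a Borel measure on the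
whole space without mass at the origin. -/
structure IsLevyMeasure (ν : Measure (EuclideanSpace ℝ ι)) : Prop where
  zero : ν {0} = 0
  lintegral_lt_top : ∫⁻ x, ENNReal.ofReal (min (‖x‖ ^ 2) 1) ∂ν < ∞

/-- The Lévy exponent
`Ψ(θ) = i⟨γ,θ⟩ - ½ θ C θ' + ∫ (exp(i⟨θ,x⟩) - 1 - i⟨θ,x⟩ 1_𝔻(x)) ν(dx)`,
where `𝔻` is the closed Euclidean unit ball. -/
def levyExponent (γ : EuclideanSpace ℝ ι) (C : Matrix ι ι ℝ)
    (ν : Measure (EuclideanSpace ℝ ι)) (θ : EuclideanSpace ℝ ι) : ℂ :=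
  Complex.I * ((inner ℝ γ θ : ℝ) : ℂ)
    - (1 / 2) * ((∑ k, ∑ l, θ k * C k l * θ l : ℝ) : ℂ)
    + ∫ x, (Complex.exp (Complex.I * ((inner ℝ θ x : ℝ) : ℂ)) - 1
        - Complex.I * (((Metric.closedBall (0 : EuclideanSpace ℝ ι) 1).indicator
            (fun y => inner ℝ θ y) x : ℝ) : ℂ)) ∂ν

/-- `X ∼ L(γ, C, ν)`: `X` is a Lévy process with canonical triplet `(γ, C, ν)`. -/
structure HasTriplet (X : ℝ≥0 → Ω → EuclideanSpace ℝ ι) (P : Measure Ω)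
    (γ : EuclideanSpace ℝ ι) (C : Matrix ι ι ℝ) (ν : Measure (EuclideanSpace ℝ ι)) : Prop where
  isLevyProcess : IsLevyProcess X P
  posSemidef : C.PosSemidef
  isLevyMeasure : IsLevyMeasure ν
  charFun_eq : ∀ (t : ℝ≥0) (θ : EuclideanSpace ℝ ι),
    charFun (P.map (X t)) θ = Complex.exp ((t : ℂ) * levyExponent γ C ν θ)

/-- `X ∼ FV(d, ν)`: a Lévy process of finite variation with drift `d`, that is, with
Gaussian covariance zero, `∫_{𝔻∖{0}} ‖x‖ ν(dx) < ∞` and `d = γ - ∫_{𝔻∖{0}} x ν(dx)`. -/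
def IsFiniteVariation (X : ℝ≥0 → Ω → EuclideanSpace ℝ ι) (P : Measure Ω)
    (d : EuclideanSpace ℝ ι) (ν : Measure (EuclideanSpace ℝ ι)) : Prop :=
  ∃ γ : EuclideanSpace ℝ ι, HasTriplet X P γ 0 ν ∧
    IntegrableOn (fun x => x) (Metric.closedBall 0 1 \ {0}) ν ∧
    d = γ - ∫ x in Metric.closedBall 0 1 \ {0}, x ∂ν

/-- `T ∼ S(d, τ)`: a subordinator, i.e. a Lévy process with nondecreasing components, with
drift `d ∈ [0, ∞)^ι` and Lévy measure `τ`. -/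
structure IsSubordinator (T : ℝ≥0 → Ω → EuclideanSpace ℝ ι) (P : Measure Ω)
    (d : EuclideanSpace ℝ ι) (τ : Measure (EuclideanSpace ℝ ι)) : Prop where
  isFiniteVariation : IsFiniteVariation T P d τ
  drift_nonneg : ∀ k, 0 ≤ d k
  monotone : ∀ᵐ ω ∂P, ∀ k, Monotone (fun t => T t ω k)

/-- The vector `X(t) = (X₁(t₁), …, Xₙ(tₙ))` for a multivariate time point `t ∈ [0, ∞)^ι`
(negative coordinates, which are never relevant, are read as `0`). -/
def evalAt (X : ℝ≥0 → Ω → EuclideanSpace ℝ ι) (t : EuclideanSpace ℝ ι) (ω : Ω) :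
    EuclideanSpace ℝ ι :=
  WithLp.toLp 2 fun k => X (t k).toNNReal ω k

/-- The set `[0, ∞)^ι ∖ {0}`. -/
def puncturedOrthant (ι : Type*) : Set (EuclideanSpace ℝ ι) :=
  {t | (∀ k, 0 ≤ t k) ∧ t ≠ 0}

/-- The coordinate projection `π_J` onto the coordinates in `J`. -/
def proj (J : Set ι) (x : EuclideanSpace ℝ ι) : EuclideanSpace ℝ ι :=
  WithLp.toLp 2 (J.indicator x)

/-- The projected measure `ν_J` on the punctured space: the image of `ν` under `π_J` with any mass
at the origin removed. -/
def projMeasure (J : Set ι) (ν : Measure (EuclideanSpace ℝ ι)) : Measure (EuclideanSpace ℝ ι) :=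
  (ν.map (proj J)).restrict {0}ᶜ

/-- The pair `(x, y)` as a vector in the Euclidean space of doubled dimension. -/
def pair (x y : EuclideanSpace ℝ ι) : EuclideanSpace ℝ (ι ⊕ ι) :=
  WithLp.toLp 2 (Sum.elim x y)

end Levy

section MultivariateTime

variable {n : ℕ}

/-- With the ordering `t_(1) ≤ … ≤ t_(n)` of the coordinates (index shifted by one in `Fin n`),
the spacing `Δt_(k) = t_(k) - t_(k-1)`, where `t_(0) = 0`. -/
def spacing (t : EuclideanSpace ℝ (Fin n)) (k : Fin n) : ℝ :=
  t (Tuple.sort t k) -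
    if (k : ℕ) = 0 then 0 else t (Tuple.sort t ⟨(k : ℕ) - 1, by have := k.isLt; omega⟩)

/-- The set `{(k), …, (n)}` of coordinates. -/
def upperSet (t : EuclideanSpace ℝ (Fin n)) (k : Fin n) : Set (Fin n) :=
  {j | ∃ m, k ≤ m ∧ j = Tuple.sort t m}

/-- The outer product `t ⋄ μ = (t₁ μ₁, …, tₙ μₙ)`. -/
def diamondVec (t μ : EuclideanSpace ℝ (Fin n)) : EuclideanSpace ℝ (Fin n) :=
  WithLp.toLp 2 fun k => t k * μ k

/-- The outer product `(t ⋄ C)_{kl} = C_{kl} (t_k ∧ t_l)`. -/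
def diamondMat (t : EuclideanSpace ℝ (Fin n)) (C : Matrix (Fin n) (Fin n) ℝ) :
    Matrix (Fin n) (Fin n) ℝ :=
  Matrix.of fun k l => C k l * min (t k) (t l)

/-- The outer product `t ⋄ ν = ∑ₖ Δt_(k) ν_{{(k), …, (n)}}`. -/
def diamondMeasure (t : EuclideanSpace ℝ (Fin n)) (ν : Measure (EuclideanSpace ℝ (Fin n))) :
    Measure (EuclideanSpace ℝ (Fin n)) :=
  ∑ k, ENNReal.ofReal (spacing t k) • projMeasure (upperSet t k) ν

/-- The compensation term
`c(t, ν) = ∑_{k=2}^n Δt_(k) ∫_{𝔻ᶜ} π_{{(k), …, (n)}}(x) 1_𝔻(π_{{(k), …, (n)}}(x)) ν(dx)`. -/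
def compensation (t : EuclideanSpace ℝ (Fin n)) (ν : Measure (EuclideanSpace ℝ (Fin n))) :
    EuclideanSpace ℝ (Fin n) :=
  ∑ k ∈ Finset.univ.filter (fun k : Fin n => (k : ℕ) ≠ 0), spacing t k •
    ∫ x in (Metric.closedBall 0 1)ᶜ,
      (Metric.closedBall 0 1).indicator (fun y => y) (proj (upperSet t k) x) ∂ν

end MultivariateTime

section Weak

variable {n : ℕ} {Ω Ω' : Type*} [MeasurableSpace Ω] [MeasurableSpace Ω']

/-- `m₁ = d + ∫_{[0,∞)ⁿ∖{0}} t P((t, X(t)) ∈ 𝔻) τ(dt)`. -/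
def weakLoc₁ (X : ℝ≥0 → Ω → EuclideanSpace ℝ (Fin n)) (P : Measure Ω)
    (d : EuclideanSpace ℝ (Fin n)) (τ : Measure (EuclideanSpace ℝ (Fin n))) :
    EuclideanSpace ℝ (Fin n) :=
  d + ∫ t in puncturedOrthant (Fin n),
    P.real {ω | pair t (evalAt X t ω) ∈ Metric.closedBall 0 1} • t ∂τ

/-- `m₂ = c(d, ν) + d ⋄ μ + ∫_{[0,∞)ⁿ∖{0}} E[X(t) 1_𝔻(t, X(t))] τ(dt)`. -/
def weakLoc₂ (X : ℝ≥0 → Ω → EuclideanSpace ℝ (Fin n)) (P : Measure Ω)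
    (μ : EuclideanSpace ℝ (Fin n)) (ν : Measure (EuclideanSpace ℝ (Fin n)))
    (d : EuclideanSpace ℝ (Fin n)) (τ : Measure (EuclideanSpace ℝ (Fin n))) :
    EuclideanSpace ℝ (Fin n) :=
  compensation d ν + diamondVec d μ + ∫ t in puncturedOrthant (Fin n),
    (∫ ω in {ω | pair t (evalAt X t ω) ∈ Metric.closedBall 0 1}, evalAt X t ω ∂P) ∂τ

/-- `Θ = [[0, 0], [0, d ⋄ C]]`. -/
def weakCov (C : Matrix (Fin n) (Fin n) ℝ) (d : EuclideanSpace ℝ (Fin n)) :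
    Matrix (Fin n ⊕ Fin n) (Fin n ⊕ Fin n) ℝ :=
  Matrix.fromBlocks 0 0 0 (diamondMat d C)

/-- The Lévy measure `δ₀ ⊗ (d ⋄ ν) + 1_{([0,∞)ⁿ∖{0}) × ℝⁿ} P(X(t) ∈ dx) τ(dt)`. Here `δ₀ ⊗ ρ` is
written as the image of `ρ` under `x ↦ (0, x)`, and `P(X(t) ∈ dx) τ(dt)` as the mixture over
`τ(dt)` of the laws of `(t, X(t))`. -/
def weakLevyMeasure (X : ℝ≥0 → Ω → EuclideanSpace ℝ (Fin n)) (P : Measure Ω)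
    (ν : Measure (EuclideanSpace ℝ (Fin n)))
    (d : EuclideanSpace ℝ (Fin n)) (τ : Measure (EuclideanSpace ℝ (Fin n))) :
    Measure (EuclideanSpace ℝ (Fin n ⊕ Fin n)) :=
  (diamondMeasure d ν).map (fun x => pair 0 x)
    + (τ.restrict (puncturedOrthant (Fin n))).bind
        (fun t => P.map (fun ω => pair t (evalAt X t ω)))

/-- `Z ≗ (T, X ⊙ T)` in the weak sense, for `X ∼ L(μ, C, ν)` under `P` and `T ∼ S(d, τ)`:
`Z` is a `2n`-dimensional Lévy process, on a possibly different probability space, with the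
prescribed triplet. -/
def IsWeakSubordination (Z : ℝ≥0 → Ω' → EuclideanSpace ℝ (Fin n ⊕ Fin n)) (P' : Measure Ω')
    (X : ℝ≥0 → Ω → EuclideanSpace ℝ (Fin n)) (P : Measure Ω)
    (μ : EuclideanSpace ℝ (Fin n)) (C : Matrix (Fin n) (Fin n) ℝ)
    (ν : Measure (EuclideanSpace ℝ (Fin n)))
    (d : EuclideanSpace ℝ (Fin n)) (τ : Measure (EuclideanSpace ℝ (Fin n))) : Prop :=
  HasTriplet Z P' (pair (weakLoc₁ X P d τ) (weakLoc₂ X P μ ν d τ)) (weakCov C d)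
    (weakLevyMeasure X P ν d τ)

end Weak

end WeakSubordination

end

noncomputable section

set_option linter.unusedSectionVars false

namespace WeakSubordination

/-! ### Analytic continuation of characteristic functions to complex functionals -/

section Laplace

/-! The two laws are compared through characteristic functions. Let `K` be the cone `0 ≤ s₁ ≤ … ≤
sₙ`. For `s ∈ K`, `X(s)` is almost surely the sum over `j` of the projections to coordinates `j, …,
n` of the increments of `X` over `[sⱼ₋₁, sⱼ]`, with `s₀ = 0`. These are independent, so `E exp(i⟨θ,
X(s)⟩) = exp(L_θ(s))`, where `L_θ(s) = ∑ⱼ (sⱼ - sⱼ₋₁) Ψ(π_{j,…,n} θ)` is linear in `s`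
(`integral_exp_imInner_evalAt`). This linearity is what monotone components provide: conditioning on
`T(t)` turns the characteristic function of `(T(t), X(T(t)))` into `E exp(Λ(T(t)))`, where `Λ =
i⟨θ₁, ·⟩ + L_{θ₂}` is a complex functional with nonpositive real part on `K`.

The Lévy–Khintchine formula for `T` is known only at purely imaginary functionals. To reach `Λ`,
replace `Re Λ` by `ζ Re Λ`: both sides are bounded and holomorphic for `Re ζ > 0` and agree on the
imaginary axis, so they agree at `ζ = 1` by Phragmén–Lindelöf (`integral_exp_eq_exp_cumulant`). This
requires `d ∈ K` and `τ` carried by `K`, both read off from small times: `T(s)/s → d` in law, and `E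
g(T(s))/s → ∫ g dτ` for test functions `g` supported off `K` (`drift_mem_of_ae_mem`,
`levyMeasure_ae_mem_of_ae_mem`).

For `Z`, the drift part of the triplet contributes `L_{θ₂}(d)` (`levyExponent_diamond`), and the
mixture of the laws of `(s, X(s))` contributes `∫ (exp Λ - 1) dτ`, its truncation terms being
cancelled by the integrals in `m₁` and `m₂` (`levyExponent_weakSubordination`). Both exponents are
thus `Λ(d) + ∫ (exp Λ - 1) dτ`. -/

lemma norm_exp_sub_one_le_norm {z : ℂ} (hz : z.re ≤ 0) : ‖Complex.exp z - 1‖ ≤ ‖z‖ := by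
  have h := (convex_halfSpace_re_le 0).norm_image_sub_le_of_norm_deriv_le (𝕜 := ℂ)
    (f := Complex.exp) (C := 1) (x := 0) (y := z)
    (fun x _ => Complex.differentiable_exp x) (fun x hx => by
      rw [Complex.deriv_exp, Complex.norm_exp]
      exact Real.exp_le_one_iff.2 hx) (by simp) hz
  simpa using h

lemma norm_exp_le_one {z : ℂ} (hz : z.re ≤ 0) : ‖Complex.exp z‖ ≤ 1 := by
  rw [Complex.norm_exp]
  exact Real.exp_le_one_iff.2 hz

lemma norm_exp_sub_one_le_two {z : ℂ} (hz : z.re ≤ 0) : ‖Complex.exp z - 1‖ ≤ 2 := by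
  calc _ ≤ ‖Complex.exp z‖ + ‖(1 : ℂ)‖ := norm_sub_le _ _
    _ ≤ 1 + 1 := by gcongr; exacts [norm_exp_le_one hz, by simp]
    _ = 2 := by norm_num

variable {E : Type*} [NormedAddCommGroup E] [InnerProductSpace ℝ E] [FiniteDimensional ℝ E]
  [MeasurableSpace E] [BorelSpace E]

lemma norm_exp_sub_one_le_min {z : ℂ} (hz : z.re ≤ 0) {c : ℝ} (hc : 0 ≤ c) {x : E}
    (h : ‖z‖ ≤ c * ‖x‖) : ‖Complex.exp z - 1‖ ≤ (2 + c) * min 1 ‖x‖ := by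
  rcases le_total 1 ‖x‖ with hx | hx
  · rw [min_eq_left hx]
    linarith [norm_exp_sub_one_le_two hz]
  · rw [min_eq_right hx]
    nlinarith [norm_exp_sub_one_le_norm hz, norm_nonneg x]

/-- The functional `x ↦ i⟨θ, x⟩`. -/
def imInner (θ : E) : E →L[ℝ] ℂ := Complex.I • (Complex.ofRealCLM ∘L innerSL ℝ θ)

lemma imInner_apply (θ x : E) : imInner θ x = Complex.I * ((inner ℝ θ x : ℝ) : ℂ) := by
  simp [imInner]

lemma imInner_re (θ x : E) : (imInner θ x).re = 0 := by simp [imInner_apply]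

/-- The cumulant `Λ(d) + ∫ (exp(Λ(x)) - 1) τ(dx)` of a finite variation Lévy process with drift `d`
and Lévy measure `τ`, at a complex linear functional `Λ`. -/
def cumulant (d : E) (τ : Measure E) (Λ : E →L[ℝ] ℂ) : ℂ :=
  Λ d + ∫ x, (Complex.exp (Λ x) - 1) ∂τ

lemma integrable_exp_sub_one {τ : Measure E} (hτ : Integrable (fun x => min 1 ‖x‖) τ)
    {Λ : E →L[ℝ] ℂ} (hΛ : ∀ᵐ x ∂τ, (Λ x).re ≤ 0) :
    Integrable (fun x => Complex.exp (Λ x) - 1) τ := by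
  refine (hτ.const_mul (2 + ‖Λ‖)).mono' (by fun_prop) ?_
  filter_upwards [hΛ] with x hx
  exact norm_exp_sub_one_le_min hx (norm_nonneg _) (Λ.le_opNorm x)

/-- The functional `ζ Re Λ + i Im Λ`. -/
def tilt (Λ : E →L[ℝ] ℂ) (ζ : ℂ) : E →L[ℝ] ℂ :=
  ζ • (Complex.ofRealCLM ∘L Complex.reCLM ∘L Λ)
    + Complex.I • (Complex.ofRealCLM ∘L Complex.imCLM ∘L Λ)

lemma tilt_apply (Λ : E →L[ℝ] ℂ) (ζ : ℂ) (x : E) :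
    tilt Λ ζ x = ζ * ((Λ x).re : ℂ) + Complex.I * ((Λ x).im : ℂ) := by
  simp [tilt]

lemma tilt_one (Λ : E →L[ℝ] ℂ) : tilt Λ 1 = Λ := by
  ext x
  rw [tilt_apply, one_mul, mul_comm Complex.I, Complex.re_add_im]

lemma tilt_re (Λ : E →L[ℝ] ℂ) (ζ : ℂ) (x : E) : (tilt Λ ζ x).re = ζ.re * (Λ x).re := by
  simp [tilt_apply]

lemma tilt_re_nonpos {Λ : E →L[ℝ] ℂ} {ζ : ℂ} {x : E} (hζ : 0 ≤ ζ.re) (hx : (Λ x).re ≤ 0) :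
    (tilt Λ ζ x).re ≤ 0 := by
  rw [tilt_re]
  exact mul_nonpos_of_nonneg_of_nonpos hζ hx

lemma norm_tilt_apply_le (Λ : E →L[ℝ] ℂ) (ζ : ℂ) (x : E) :
    ‖tilt Λ ζ x‖ ≤ (‖ζ‖ + 1) * ‖Λ‖ * ‖x‖ := by
  rw [tilt_apply]
  calc _ ≤ ‖ζ * ((Λ x).re : ℂ)‖ + ‖Complex.I * ((Λ x).im : ℂ)‖ := norm_add_le _ _
    _ = ‖ζ‖ * |(Λ x).re| + |(Λ x).im| := by simp
    _ ≤ ‖ζ‖ * ‖Λ x‖ + ‖Λ x‖ := by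
      gcongr
      exacts [Complex.abs_re_le_norm _, Complex.abs_im_le_norm _]
    _ = (‖ζ‖ + 1) * ‖Λ x‖ := by ring
    _ ≤ _ := by
      rw [mul_assoc]
      gcongr
      exact Λ.le_opNorm x

/-- At `ζ = iy` the tilt is `i (y Re Λ + Im Λ)`, that is `i` times a real functional, which Riesz
representation turns into an inner product. On the imaginary axis only ordinary characteristic
functions are therefore involved. -/
lemma tilt_mul_I (Λ : E →L[ℝ] ℂ) (y : ℝ) : ∃ θ : E, tilt Λ (y * Complex.I) = imInner θ := by
  refine ⟨(InnerProductSpace.toDual ℝ E).symm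
    (y • (Complex.reCLM ∘L Λ) + Complex.imCLM ∘L Λ), ?_⟩
  ext x
  rw [tilt_apply, imInner_apply, InnerProductSpace.toDual_symm_apply]
  simp
  ring

lemma mul_exp_neg_mul_le {r a : ℝ} (hr : 0 < r) (ha : 0 ≤ a) :
    a * Real.exp (-(r * a)) ≤ min a r⁻¹ := by
  have h1 : Real.exp (-(r * a)) ≤ 1 := Real.exp_le_one_iff.2 (by nlinarith)
  refine le_min (by nlinarith) ?_
  have h2 := Real.add_one_le_exp (r * a)
  rw [Real.exp_neg, ← div_eq_mul_inv, div_le_iff₀ (Real.exp_pos _), ← div_eq_inv_mul,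
    le_div_iff₀ hr]
  linarith

/-- The `ζ`-derivative brings down the factor `Re Λ(x)`. It is `O(‖x‖)` near the origin, and for
large `x` the decay of `exp(Re ζ Re Λ(x))` keeps it bounded, so no first moment of `τ` is needed. On
the closed half-plane, continuity follows by dominated convergence. -/
lemma diffContOnCl_integral_exp_tilt {τ : Measure E} (hτ : Integrable (fun x => min 1 ‖x‖) τ)
    {Λ : E →L[ℝ] ℂ} (hΛ : ∀ᵐ x ∂τ, (Λ x).re ≤ 0) :
    DiffContOnCl ℂ (fun ζ => ∫ x, (Complex.exp (tilt Λ ζ x) - 1) ∂τ) {ζ | 0 < ζ.re} := by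
  constructor
  · intro ζ₀ hζ₀
    have hζ₀' : 0 < ζ₀.re := hζ₀
    -- With `Re ζ₀ = 2r`, the ball of radius `r` about `ζ₀` stays in `Re ζ ≥ r`.
    obtain ⟨r, hr, hr2⟩ : ∃ r, 0 < r ∧ ζ₀.re = 2 * r := ⟨ζ₀.re / 2, by linarith, by ring⟩
    have hball : ∀ ζ ∈ Metric.ball ζ₀ r, r ≤ ζ.re := by
      intro ζ hζ
      have h := (Complex.abs_re_le_norm (ζ - ζ₀)).trans_lt (mem_ball_iff_norm.1 hζ)
      rw [Complex.sub_re] at h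
      linarith [(abs_lt.1 h).1]
    refine (hasDerivAt_integral_of_dominated_loc_of_deriv_le (𝕜 := ℂ)
      (F := fun ζ x => Complex.exp (tilt Λ ζ x) - 1)
      (F' := fun ζ x => Complex.exp (tilt Λ ζ x) * ((Λ x).re : ℂ))
      (bound := fun x => (‖Λ‖ + r⁻¹) * min 1 ‖x‖) (Metric.ball_mem_nhds ζ₀ hr)
      (Eventually.of_forall fun ζ => by fun_prop)
      (integrable_exp_sub_one hτ (hΛ.mono fun x hx => tilt_re_nonpos hζ₀'.le hx))
      (by fun_prop) ?_ (hτ.const_mul _) ?_).2.differentiableAt.differentiableWithinAt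
    · filter_upwards [hΛ] with x hx ζ hζ
      rw [norm_mul, Complex.norm_exp, tilt_re, Complex.norm_real, Real.norm_eq_abs,
        abs_of_nonpos hx]
      have h1 : Real.exp (ζ.re * (Λ x).re) ≤ Real.exp (-(r * -(Λ x).re)) := by
        apply Real.exp_le_exp.2
        nlinarith [hball ζ hζ]
      have h2 := mul_exp_neg_mul_le hr (neg_nonneg.2 hx)
      have h3 : -(Λ x).re ≤ ‖Λ‖ * ‖x‖ :=
        ((neg_le_abs _).trans (Complex.abs_re_le_norm _)).trans (Λ.le_opNorm x)
      have h4 : Real.exp (ζ.re * (Λ x).re) * -(Λ x).re ≤ min (-(Λ x).re) r⁻¹ := by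
        nlinarith
      refine h4.trans ?_
      have hr' : 0 < r⁻¹ := inv_pos.2 hr
      rcases le_total 1 ‖x‖ with h | h
      · rw [min_eq_left h]
        linarith [min_le_right (-(Λ x).re) r⁻¹, norm_nonneg Λ]
      · rw [min_eq_right h]
        nlinarith [min_le_left (-(Λ x).re) r⁻¹, norm_nonneg x]
    · refine Eventually.of_forall fun x ζ _ => ?_
      simp only [tilt_apply]
      have h : HasDerivAt (fun ζ : ℂ => ζ * ((Λ x).re : ℂ) + Complex.I * ((Λ x).im : ℂ))
          ((Λ x).re : ℂ) ζ := by
        simpa using ((hasDerivAt_id ζ).mul_const ((Λ x).re : ℂ)).add_const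
          (Complex.I * ((Λ x).im : ℂ))
      exact h.cexp.sub_const 1
  · have hcl : closure {ζ : ℂ | 0 < ζ.re} = {ζ | 0 ≤ ζ.re} := Complex.closure_setOfPred_lt_re 0
    rw [hcl]
    intro ζ₀ hζ₀
    refine continuousWithinAt_of_dominated
      (bound := fun x => (2 + (‖ζ₀‖ + 1 + 1) * ‖Λ‖) * min 1 ‖x‖)
      (Eventually.of_forall fun ζ => by fun_prop) ?_ (hτ.const_mul _)
      (Eventually.of_forall fun x => ?_)
    · have hnear : ∀ᶠ ζ in 𝓝[{ζ : ℂ | 0 ≤ ζ.re}] ζ₀, ‖ζ‖ < ‖ζ₀‖ + 1 :=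
        (continuous_norm.continuousWithinAt.tendsto).eventually_lt_const (by simp)
      filter_upwards [hnear, self_mem_nhdsWithin] with ζ hζ hζ'
      filter_upwards [hΛ] with x hx
      refine norm_exp_sub_one_le_min (tilt_re_nonpos hζ' hx) (by positivity)
        ((norm_tilt_apply_le Λ ζ x).trans ?_)
      gcongr
    · simp only [tilt_apply]
      fun_prop

/-- Analytic extension of the characteristic function of a finite variation infinitely divisible law
to complex functionals whose real part is nonpositive on the support. -/
theorem integral_exp_eq_exp_cumulant {ρ : Measure E} [IsProbabilityMeasure ρ] {τ : Measure E}
    (hτ : Integrable (fun x => min 1 ‖x‖) τ) {d : E} {t : ℝ} (ht : 0 ≤ t)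
    (hchar : ∀ θ, ∫ x, Complex.exp (imInner θ x) ∂ρ = Complex.exp (t * cumulant d τ (imInner θ)))
    {Λ : E →L[ℝ] ℂ} (hρΛ : ∀ᵐ x ∂ρ, (Λ x).re ≤ 0) (hτΛ : ∀ᵐ x ∂τ, (Λ x).re ≤ 0)
    (hd : (Λ d).re ≤ 0) :
    ∫ x, Complex.exp (Λ x) ∂ρ = Complex.exp (t * cumulant d τ Λ) := by
  have hρ : Integrable (fun x => min 1 ‖x‖) ρ := by
    refine (integrable_const (1 : ℝ)).mono' (by fun_prop) (Eventually.of_forall fun x => ?_)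
    rw [Real.norm_of_nonneg (by positivity)]
    exact min_le_left _ _
  -- Splitting off the constant `1` brings the transform of `ρ` into the form covered by
  -- `diffContOnCl_integral_exp_tilt`.
  have hI : ∀ {Λ' : E →L[ℝ] ℂ}, (∀ᵐ x ∂ρ, (Λ' x).re ≤ 0) →
      ∫ x, Complex.exp (Λ' x) ∂ρ = 1 + ∫ x, (Complex.exp (Λ' x) - 1) ∂ρ := by
    intro Λ' h
    have := integral_add (integrable_const (μ := ρ) (1 : ℂ)) (integrable_exp_sub_one hρ h)
    simpa using this
  set f : ℂ → ℂ := fun ζ => (1 + ∫ x, (Complex.exp (tilt Λ ζ x) - 1) ∂ρ)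
    - Complex.exp (t * cumulant d τ (tilt Λ ζ)) with hf
  have hbound : ∀ ζ : ℂ, 0 ≤ ζ.re → ‖f ζ‖ ≤ 2 := by
    intro ζ hζ
    have h1 : ‖1 + ∫ x, (Complex.exp (tilt Λ ζ x) - 1) ∂ρ‖ ≤ 1 := by
      rw [← hI (hρΛ.mono fun x hx => tilt_re_nonpos hζ hx)]
      refine (norm_integral_le_of_norm_le_const (C := 1) ?_).trans (by simp)
      filter_upwards [hρΛ] with x hx
      exact norm_exp_le_one (tilt_re_nonpos hζ hx)
    have h2 : (t * cumulant d τ (tilt Λ ζ)).re ≤ 0 := by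
      rw [Complex.re_ofReal_mul, cumulant, Complex.add_re]
      refine mul_nonpos_of_nonneg_of_nonpos ht (add_nonpos (tilt_re_nonpos hζ hd) ?_)
      rw [← Complex.reCLM_apply, ← ContinuousLinearMap.integral_comp_comm _
        (integrable_exp_sub_one hτ (hτΛ.mono fun x hx => tilt_re_nonpos hζ hx))]
      refine integral_nonpos_of_ae ?_
      filter_upwards [hτΛ] with x hx
      have h3 := norm_exp_le_one (tilt_re_nonpos hζ hx)
      have h4 := Complex.re_le_norm (Complex.exp (tilt Λ ζ x))
      simp only [Complex.reCLM_apply, Complex.sub_re, Complex.one_re, Pi.zero_apply]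
      linarith
    calc _ ≤ _ := norm_sub_le _ _
      _ ≤ 1 + 1 := add_le_add h1 (norm_exp_le_one h2)
      _ = 2 := by norm_num
  have hdiff : DiffContOnCl ℂ f {ζ | 0 < ζ.re} := by
    refine ((diffContOnCl_integral_exp_tilt hρ hρΛ).const_add 1).sub ?_
    have h1 : DiffContOnCl ℂ (fun ζ => (t : ℂ) * cumulant d τ (tilt Λ ζ)) {ζ | 0 < ζ.re} := by
      have h2 : Differentiable ℂ fun ζ : ℂ => tilt Λ ζ d := by
        simp only [tilt_apply]
        fun_prop
      exact (h2.diffContOnCl.add (diffContOnCl_integral_exp_tilt hτ hτΛ)).const_smul (t : ℂ)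
    exact Complex.differentiable_exp.comp_diffContOnCl h1
  -- Phragmén–Lindelöf with bound `0` on the imaginary axis; exponent `1` and rate `0` reduce its
  -- growth condition to boundedness.
  have hzero : ‖f 1‖ ≤ 0 := by
    refine PhragmenLindelof.right_half_plane_of_bounded_on_real hdiff ⟨1, by norm_num, 0, ?_⟩
      ?_ (fun y => ?_) (by simp)
    · refine Asymptotics.IsBigO.of_bound 2 ?_
      refine eventually_inf_principal.2 (Eventually.of_forall fun ζ hζ => ?_)
      simpa using hbound ζ (le_of_lt hζ)
    · refine isBoundedUnder_of_eventually_le (a := 2) ?_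
      filter_upwards [eventually_ge_atTop 0] with x hx
      exact hbound x (by simpa using hx)
    · obtain ⟨θ, hθ⟩ := tilt_mul_I Λ y
      have h := hI (Λ' := imInner θ) (Eventually.of_forall fun x => (imInner_re θ x).le)
      rw [hf]
      simp only [hθ]
      rw [← h, hchar, sub_self, norm_zero]
  have h1 : f 1 = 0 := norm_le_zero_iff.1 hzero
  rw [hf] at h1
  simp only [tilt_one] at h1
  rw [hI hρΛ]
  exact sub_eq_zero.1 h1

end Laplace

/-! ### Support of the drift and of the Lévy measure, from small times -/

section Support

open scoped SchwartzMap FourierTransform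

variable {E : Type*} [NormedAddCommGroup E] [InnerProductSpace ℝ E] [FiniteDimensional ℝ E]
  [MeasurableSpace E] [BorelSpace E]

lemma norm_imInner_apply_le (θ x : E) : ‖imInner θ x‖ ≤ ‖θ‖ * ‖x‖ := by
  rw [imInner_apply, norm_mul, Complex.norm_I, one_mul, Complex.norm_real]
  exact norm_inner_le_norm θ x

lemma norm_exp_imInner (θ x : E) : ‖Complex.exp (imInner θ x)‖ = 1 := by
  rw [Complex.norm_exp, imInner_re, Real.exp_zero]

lemma norm_exp_imInner_sub_one_le (θ x : E) :
    ‖Complex.exp (imInner θ x) - 1‖ ≤ (2 + ‖θ‖) * min 1 ‖x‖ :=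
  norm_exp_sub_one_le_min (imInner_re θ x).le (norm_nonneg _) (norm_imInner_apply_le θ x)

@[fun_prop]
lemma continuous_imInner_apply {α : Type*} [TopologicalSpace α] {f g : α → E} (hf : Continuous f)
    (hg : Continuous g) : Continuous fun a => imInner (f a) (g a) := by
  simp only [imInner_apply]
  fun_prop

lemma imInner_smul (c : ℝ) (θ x : E) : imInner (c • θ) x = c * imInner θ x := by
  simp only [imInner_apply, real_inner_smul_left]
  push_cast
  ring

lemma integrable_exp_imInner_sub_one {τ : Measure E} (hτ : Integrable (fun x => min 1 ‖x‖) τ)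
    (θ : E) : Integrable (fun x => Complex.exp (imInner θ x) - 1) τ :=
  integrable_exp_sub_one hτ (Eventually.of_forall fun x => (imInner_re θ x).le)

lemma continuous_cumulant_imInner {τ : Measure E} (hτ : Integrable (fun x => min 1 ‖x‖) τ)
    (d : E) : Continuous fun θ => cumulant d τ (imInner θ) := by
  unfold cumulant
  refine Continuous.add (by fun_prop) (continuous_iff_continuousAt.2 fun θ₀ => ?_)
  refine continuousAt_of_dominated (bound := fun x => (2 + (‖θ₀‖ + 1)) * min 1 ‖x‖)
    (Eventually.of_forall fun θ => by fun_prop) ?_ (hτ.const_mul _)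
    (Eventually.of_forall fun x => by fun_prop)
  have hnear : ∀ᶠ θ in 𝓝 θ₀, ‖θ‖ < ‖θ₀‖ + 1 :=
    continuous_norm.continuousAt.tendsto.eventually_lt_const (by simp)
  filter_upwards [hnear] with θ hθ
  refine Eventually.of_forall fun x => (norm_exp_imInner_sub_one_le θ x).trans ?_
  gcongr

lemma norm_cumulant_imInner_le {τ : Measure E} (hτ : Integrable (fun x => min 1 ‖x‖) τ)
    (d θ : E) : ‖cumulant d τ (imInner θ)‖ ≤ (‖d‖ + 2 * ∫ x, min 1 ‖x‖ ∂τ) * (1 + ‖θ‖) := by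
  have h1 : ‖∫ x, (Complex.exp (imInner θ x) - 1) ∂τ‖ ≤ (2 + ‖θ‖) * ∫ x, min 1 ‖x‖ ∂τ := by
    rw [← integral_const_mul]
    exact norm_integral_le_of_norm_le (hτ.const_mul _)
      (Eventually.of_forall fun x => norm_exp_imInner_sub_one_le θ x)
  have h2 : 0 ≤ ∫ x, min 1 ‖x‖ ∂τ := integral_nonneg fun x => by positivity
  have h3 := norm_imInner_apply_le θ d
  have h4 : ‖cumulant d τ (imInner θ)‖ ≤ _ := norm_add_le _ _
  nlinarith [norm_nonneg d, norm_nonneg θ]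

lemma cumulant_imInner_re_nonpos {τ : Measure E} (hτ : Integrable (fun x => min 1 ‖x‖) τ)
    (d θ : E) : (cumulant d τ (imInner θ)).re ≤ 0 := by
  rw [cumulant, Complex.add_re, imInner_re, zero_add, ← Complex.reCLM_apply,
    ← ContinuousLinearMap.integral_comp_comm _ (integrable_exp_imInner_sub_one hτ θ)]
  refine integral_nonpos fun x => ?_
  have h := Complex.re_le_norm (Complex.exp (imInner θ x))
  rw [norm_exp_imInner] at h
  simpa using h

/-- `φ` is a Fourier density of `g`, with one moment. -/
structure IsFourierDensity (g φ : E → ℂ) : Prop where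
  continuous : Continuous φ
  integrable : Integrable φ
  integrable_norm_mul : Integrable fun ξ => ‖ξ‖ * ‖φ ξ‖
  eq : ∀ x, g x = ∫ ξ, φ ξ * Complex.exp (imInner ((2 * Real.pi) • ξ) x)

lemma isFourierDensity_schwartz (g : 𝓢(E, ℂ)) : 
    IsFourierDensity g (⇑(𝓕 g : 𝓢(E, ℂ))) where
  continuous := (𝓕 g).continuous
  integrable := (𝓕 g).integrable
  integrable_norm_mul := by
    simpa only [pow_one] using SchwartzMap.integrable_pow_mul volume (𝓕 g : 𝓢(E, ℂ)) 1
  eq x := by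
    have h : (𝓕⁻ (𝓕 g) : 𝓢(E, ℂ)) x = g x := by rw [FourierTransform.fourierInv_fourier_eq]
    rw [← h, SchwartzMap.fourierInv_coe, Real.fourierInv_eq']
    congr with ξ
    rw [smul_eq_mul, mul_comm, imInner_apply, real_inner_smul_left, mul_comm Complex.I]

namespace IsFourierDensity

variable {g φ : E → ℂ}

lemma integrable_one_add (h : IsFourierDensity g φ) (C : ℝ) :
    Integrable fun ξ => ‖φ ξ‖ * (C * (1 + ‖ξ‖)) := by
  have := (h.integrable.norm.add h.integrable_norm_mul).const_mul C
  refine this.congr (Eventually.of_forall fun ξ => ?_)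
  simp only [Pi.add_apply]
  ring

/-- Fubini expresses expectations of test functions through the characteristic function of `ρ`. It
is used with `c = 1/s` for the drift and `c = 1` for the Lévy measure. -/
lemma integral_comp_smul (h : IsFourierDensity g φ) (ρ : Measure E) [IsFiniteMeasure ρ] (c : ℝ) :
    ∫ x, g (c • x) ∂ρ
      = ∫ ξ, φ ξ * ∫ x, Complex.exp (imInner ((2 * Real.pi * c) • ξ) x) ∂ρ := by
  simp_rw [h.eq]
  have hφ := h.continuous
  rw [integral_integral_swap]
  · congr with ξ
    rw [← integral_const_mul]
    congr with x
    congr 2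
    simp only [imInner_apply, real_inner_smul_left, real_inner_smul_right]
    congr 2
    ring
  · refine (h.integrable.norm.comp_snd ρ).mono' (Continuous.aestronglyMeasurable ?_)
      (Eventually.of_forall fun p => ?_)
    · simp only [Function.uncurry_def]
      fun_prop
    · simp only [Function.uncurry_def, norm_mul, norm_exp_imInner, mul_one, le_refl]

/-- The conclusion is the right derivative at `s = 0` of `∫ φ exp(sψ)`, which vanishes for all `s ≥
0`. Since `Re ψ ≤ 0`, the difference quotients are dominated by `‖φ‖ ‖ψ‖`, integrable by the linear
growth of `ψ` and the moment of `φ`. -/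
lemma integral_mul_eq_zero (h : IsFourierDensity g φ) {ψ : E → ℂ} (hψ : Continuous ψ) {C : ℝ}
    (hC : ∀ ξ, ‖ψ ξ‖ ≤ C * (1 + ‖ξ‖)) (hre : ∀ ξ, (ψ ξ).re ≤ 0)
    (hzero : ∀ s : ℝ, 0 < s → ∫ ξ, φ ξ * Complex.exp (s * ψ ξ) = 0) (hφ0 : ∫ ξ, φ ξ = 0) :
    ∫ ξ, φ ξ * ψ ξ = 0 := by
  have hφ := h.continuous
  have hlim : Tendsto (fun s : ℝ => ∫ ξ, φ ξ * (s⁻¹ * (Complex.exp (s * ψ ξ) - 1))) (𝓝[>] 0)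
      (𝓝 (∫ ξ, φ ξ * ψ ξ)) := by
    refine tendsto_integral_filter_of_dominated_convergence
      (fun ξ => ‖φ ξ‖ * (C * (1 + ‖ξ‖)))
      (Eventually.of_forall fun s => Continuous.aestronglyMeasurable (by fun_prop)) ?_
      (h.integrable_one_add C) (Eventually.of_forall fun ξ => ?_)
    · filter_upwards [self_mem_nhdsWithin] with s hs
      have hs : 0 < s := hs
      refine Eventually.of_forall fun ξ => ?_
      rw [norm_mul]
      gcongr
      have h1 : ‖Complex.exp (s * ψ ξ) - 1‖ ≤ ‖(s : ℂ) * ψ ξ‖ := by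
        refine norm_exp_sub_one_le_norm ?_
        rw [Complex.re_ofReal_mul]
        exact mul_nonpos_of_nonneg_of_nonpos hs.le (hre ξ)
      rw [norm_mul, Complex.ofReal_inv, norm_inv]
      rw [norm_mul] at h1
      have h2 : 0 < ‖(s : ℂ)‖ := by simpa using hs.ne'
      rw [inv_mul_le_iff₀ h2]
      exact h1.trans (by gcongr; exact hC ξ)
    · refine Tendsto.const_mul _ ?_
      have h1 : HasDerivAt (fun s : ℝ => Complex.exp (s * ψ ξ)) (ψ ξ) 0 := by
        have h2 : HasDerivAt (fun s : ℝ => (s : ℂ) * ψ ξ) (ψ ξ) 0 := by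
          simpa using (Complex.ofRealCLM.hasDerivAt (x := (0 : ℝ))).mul_const (ψ ξ)
        simpa using h2.cexp
      have h3 := h1.tendsto_slope_zero_right
      simpa using h3
  refine tendsto_nhds_unique hlim (tendsto_const_nhds.congr' ?_)
  filter_upwards [self_mem_nhdsWithin] with s hs
  have hs : 0 < s := hs
  have hint : Integrable fun ξ => φ ξ * Complex.exp (s * ψ ξ) := by
    refine h.integrable.norm.mono' (Continuous.aestronglyMeasurable (by fun_prop))
      (Eventually.of_forall fun ξ => ?_)
    rw [norm_mul]
    refine mul_le_of_le_one_right (norm_nonneg _) (norm_exp_le_one ?_)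
    rw [Complex.re_ofReal_mul]
    exact mul_nonpos_of_nonneg_of_nonpos hs.le (hre ξ)
  have h4 : ∫ ξ, (s : ℂ)⁻¹ * (φ ξ * Complex.exp (s * ψ ξ) - φ ξ) = 0 := by
    rw [integral_const_mul, integral_sub hint h.integrable, hzero s hs, hφ0]
    simp
  rw [← h4]
  congr with ξ
  rw [Complex.ofReal_inv]
  ring

end IsFourierDensity

/-- A closed cone that carries all one-dimensional marginals of a finite variation Lévy process
contains its drift. -/
theorem drift_mem_of_ae_mem {τ : Measure E} (hτ : Integrable (fun x => min 1 ‖x‖) τ) {d : E}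
    {ρ : ℝ → Measure E} [∀ s, IsProbabilityMeasure (ρ s)]
    (hchar : ∀ s, 0 < s → ∀ θ,
      ∫ x, Complex.exp (imInner θ x) ∂ρ s = Complex.exp (s * cumulant d τ (imInner θ)))
    {K : Set E} (hK : IsClosed K) (hcone : ∀ c : ℝ, 0 < c → ∀ x ∈ K, c • x ∈ K)
    (hmem : ∀ s, 0 < s → ∀ᵐ x ∂ρ s, x ∈ K) : d ∈ K := by
  by_contra hd
  obtain ⟨u, hu1, hu2, hu3, -, hu4⟩ :=
    exists_contDiff_tsupport_subset (n := ⊤) (hK.isOpen_compl.mem_nhds hd)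
  have hu2' : HasCompactSupport (Complex.ofRealCLM ∘ u) := hu2.comp_left rfl
  set g := hu2'.toSchwartzMap (Complex.ofRealCLM.contDiff.comp hu3)
  have hg : ∀ x, g x = (u x : ℂ) := fun x => rfl
  have hgK : ∀ x ∈ K, g x = 0 := fun x hx => by
    rw [hg, image_eq_zero_of_notMem_tsupport fun h => hu1 h hx, Complex.ofReal_zero]
  have hφ := isFourierDensity_schwartz g
  set φ : E → ℂ := ⇑(𝓕 g : 𝓢(E, ℂ))
  have hφc := hφ.continuous
  have hcont := continuous_cumulant_imInner hτ d
  -- The Fourier form of `E g(T(s)/s) → g(d)` as `s → 0`.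
  have hlim : Tendsto (fun s : ℝ => ∫ ξ, φ ξ *
      Complex.exp (s * cumulant d τ (imInner ((2 * Real.pi * s⁻¹) • ξ)))) (𝓝[>] 0)
      (𝓝 (∫ ξ, φ ξ * Complex.exp (imInner ((2 * Real.pi) • ξ) d))) := by
    refine tendsto_integral_filter_of_dominated_convergence (fun ξ => ‖φ ξ‖)
      (Eventually.of_forall fun s => Continuous.aestronglyMeasurable ?_) ?_ hφ.integrable.norm
      (Eventually.of_forall fun ξ => ?_)
    · exact hφc.mul (Complex.continuous_exp.comp
        (continuous_const.mul (hcont.comp (continuous_const.smul continuous_id))))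
    · filter_upwards [self_mem_nhdsWithin] with s hs
      have hs : 0 < s := hs
      refine Eventually.of_forall fun ξ => ?_
      rw [norm_mul]
      refine mul_le_of_le_one_right (norm_nonneg _) (norm_exp_le_one ?_)
      rw [Complex.re_ofReal_mul]
      exact mul_nonpos_of_nonneg_of_nonpos hs.le (cumulant_imInner_re_nonpos hτ d _)
    · refine Tendsto.const_mul _ (Complex.continuous_exp.continuousAt.tendsto.comp ?_)
      set η : E := (2 * Real.pi) • ξ
      -- The jump part of `s` times the cumulant at `η/s` is at most `2s` pointwise, and dominated
      -- by `(2 + ‖η‖) min(1, ‖x‖)` for `s < 1`, so only the drift survives.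
      have h1 : Tendsto (fun s : ℝ => imInner η d
          + ∫ x, (s : ℂ) * (Complex.exp (imInner (s⁻¹ • η) x) - 1) ∂τ) (𝓝[>] 0)
          (𝓝 (imInner η d + ∫ _, (0 : ℂ) ∂τ)) := by
        refine tendsto_const_nhds.add (tendsto_integral_filter_of_dominated_convergence
          (fun x => (2 + ‖η‖) * min 1 ‖x‖)
          (Eventually.of_forall fun s => Continuous.aestronglyMeasurable (by fun_prop)) ?_
          (hτ.const_mul _) (Eventually.of_forall fun x => ?_))
        · filter_upwards [Ioo_mem_nhdsGT (zero_lt_one' ℝ)] with s hs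
          refine Eventually.of_forall fun x => ?_
          rw [norm_mul, Complex.norm_real, Real.norm_of_nonneg hs.1.le]
          refine (mul_le_mul_of_nonneg_left (norm_exp_imInner_sub_one_le _ x) hs.1.le).trans ?_
          rw [← mul_assoc, norm_smul, norm_inv, Real.norm_of_nonneg hs.1.le, mul_add,
            mul_inv_cancel_left₀ hs.1.ne']
          gcongr
          linarith [hs.2]
        · rw [tendsto_zero_iff_norm_tendsto_zero]
          have h2 : Tendsto (fun s : ℝ => s * 2) (𝓝[>] 0) (𝓝 0) := by
            have : Tendsto (fun s : ℝ => s * 2) (𝓝 0) (𝓝 (0 * 2)) :=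
              (continuous_id.mul continuous_const).tendsto 0
            rw [zero_mul] at this
            exact this.mono_left nhdsWithin_le_nhds
          refine squeeze_zero' (Eventually.of_forall fun s => norm_nonneg _) ?_ h2
          filter_upwards [self_mem_nhdsWithin] with s hs
          have hs : 0 < s := hs
          rw [norm_mul, Complex.norm_real, Real.norm_of_nonneg hs.le]
          gcongr
          exact norm_exp_sub_one_le_two (imInner_re _ x).le
      rw [integral_zero, add_zero] at h1
      refine h1.congr' ?_
      filter_upwards [self_mem_nhdsWithin] with s hs
      have hs : (s : ℂ) ≠ 0 := by simpa using (ne_of_gt hs : s ≠ 0)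
      rw [integral_const_mul, cumulant, mul_add]
      have h5 : (2 * Real.pi * s⁻¹) • ξ = s⁻¹ • η := by rw [smul_smul, mul_comm]
      rw [h5, imInner_smul s⁻¹ η d, Complex.ofReal_inv, mul_inv_cancel_left₀ hs]
  rw [← hφ.eq, hg, hu4] at hlim
  refine one_ne_zero (α := ℂ) (tendsto_nhds_unique hlim (tendsto_const_nhds.congr' ?_))
  filter_upwards [self_mem_nhdsWithin] with s hs
  have hs : 0 < s := hs
  -- The integral becomes `∫ g(x/s) ρ_s(dx)`, which is zero because `K` is a cone and `g` vanishes
  -- on it; yet its limit is `g(d) = 1`.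
  simp_rw [← hchar s hs]
  rw [← hφ.integral_comp_smul (ρ s) s⁻¹]
  symm
  refine integral_eq_zero_of_ae ?_
  filter_upwards [hmem s hs] with x hx
  exact hgK _ (hcone _ (inv_pos.2 hs) x hx)

/-- A closed cone that carries all one-dimensional marginals of a finite variation Lévy process
carries its Lévy measure. -/
theorem levyMeasure_ae_mem_of_ae_mem {τ : Measure E} [SFinite τ]
    (hτ : Integrable (fun x => min 1 ‖x‖) τ) {d : E}
    {ρ : ℝ → Measure E} [∀ s, IsProbabilityMeasure (ρ s)]
    (hchar : ∀ s, 0 < s → ∀ θ,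
      ∫ x, Complex.exp (imInner θ x) ∂ρ s = Complex.exp (s * cumulant d τ (imInner θ)))
    {K : Set E} (hK : IsClosed K) (hK0 : 0 ∈ K)
    (hcone : ∀ c : ℝ, 0 < c → ∀ x ∈ K, c • x ∈ K)
    (hmem : ∀ s, 0 < s → ∀ᵐ x ∂ρ s, x ∈ K) : ∀ᵐ x ∂τ, x ∈ K := by
  have hd := drift_mem_of_ae_mem hτ hchar hK hcone hmem
  rw [ae_iff]
  -- It suffices to find a `τ`-null neighbourhood of each point off `K`.
  refine measure_null_of_locally_null _ fun y hy => ?_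
  obtain ⟨u, hu1, hu2, hu3, hu5, hu4⟩ :=
    exists_contDiff_tsupport_subset (n := ⊤) (hK.isOpen_compl.mem_nhds hy)
  have hu2' : HasCompactSupport (Complex.ofRealCLM ∘ u) := hu2.comp_left rfl
  set g := hu2'.toSchwartzMap (Complex.ofRealCLM.contDiff.comp hu3)
  have hg : ∀ x, g x = (u x : ℂ) := fun x => rfl
  have hgK : ∀ x ∈ K, g x = 0 := fun x hx => by
    rw [hg, image_eq_zero_of_notMem_tsupport fun h => hu1 h hx, Complex.ofReal_zero]
  have hφ := isFourierDensity_schwartz g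
  set φ : E → ℂ := ⇑(𝓕 g : 𝓢(E, ℂ))
  have hφc := hφ.continuous
  have hφ0 : ∫ ξ, φ ξ = 0 := by
    have := hφ.eq 0
    rw [hgK 0 hK0] at this
    simpa using this.symm
  have hpi : ∀ ξ : E, ‖(2 * Real.pi) • ξ‖ = 2 * Real.pi * ‖ξ‖ := fun ξ => by
    rw [norm_smul, Real.norm_of_nonneg (by positivity)]
  have hgrow : ∀ {C : ℝ}, 0 ≤ C → ∀ ξ : E,
      C * (1 + ‖(2 * Real.pi) • ξ‖) ≤ (C * (2 * Real.pi)) * (1 + ‖ξ‖) := fun {C} hC ξ => by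
    rw [hpi, mul_assoc C]
    refine mul_le_mul_of_nonneg_left ?_ hC
    nlinarith [Real.pi_gt_three]
  have hcont : Continuous fun ξ : E => cumulant d τ (imInner ((2 * Real.pi) • ξ)) :=
    (continuous_cumulant_imInner hτ d).comp (continuous_const.smul continuous_id)
  have hmin : 0 ≤ ∫ x, min 1 ‖x‖ ∂τ := integral_nonneg fun x => by positivity
  -- The derivative at `s = 0` of `E g(T(s)) = 0`, in Fourier form.
  have h1 : ∫ ξ, φ ξ * cumulant d τ (imInner ((2 * Real.pi) • ξ)) = 0 := by
    refine hφ.integral_mul_eq_zero hcont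
      (fun ξ => (norm_cumulant_imInner_le hτ d _).trans (hgrow (by positivity) ξ))
      (fun ξ => cumulant_imInner_re_nonpos hτ d _) (fun s hs => ?_) hφ0
    simp_rw [← hchar s hs]
    have h2 := hφ.integral_comp_smul (ρ s) 1
    simp only [one_smul, mul_one] at h2
    rw [← h2]
    refine integral_eq_zero_of_ae ?_
    filter_upwards [hmem s hs] with x hx
    exact hgK _ hx
  -- The same derivative along the ray `s d`, which lies in `K`, where `g` vanishes.
  have h2 : ∫ ξ, φ ξ * imInner ((2 * Real.pi) • ξ) d = 0 := by
    refine hφ.integral_mul_eq_zero (C := ‖d‖ * (2 * Real.pi)) (by fun_prop) (fun ξ => ?_)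
      (fun ξ => (imInner_re _ d).le) (fun s hs => ?_) hφ0
    · refine (norm_imInner_apply_le _ d).trans (le_trans ?_ (hgrow (norm_nonneg d) ξ))
      nlinarith [norm_nonneg d]
    · have h3 := hφ.eq (s • d)
      rw [hgK _ (hcone s hs d hd)] at h3
      rw [h3]
      congr with ξ
      rw [map_smul, Complex.real_smul]
  have hint1 : Integrable fun ξ => φ ξ * cumulant d τ (imInner ((2 * Real.pi) • ξ)) := by
    refine (hφ.integrable_one_add ((‖d‖ + 2 * ∫ x, min 1 ‖x‖ ∂τ) * (2 * Real.pi))).mono'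
      (Continuous.aestronglyMeasurable (hφc.mul hcont)) (Eventually.of_forall fun ξ => ?_)
    rw [norm_mul]
    gcongr
    exact (norm_cumulant_imInner_le hτ d _).trans (hgrow (by positivity) ξ)
  have hint2 : Integrable fun ξ => φ ξ * imInner ((2 * Real.pi) • ξ) d := by
    refine (hφ.integrable_one_add (‖d‖ * (2 * Real.pi))).mono'
      (Continuous.aestronglyMeasurable (by fun_prop)) (Eventually.of_forall fun ξ => ?_)
    rw [norm_mul]
    gcongr
    refine (norm_imInner_apply_le _ d).trans (le_trans ?_ (hgrow (norm_nonneg d) ξ))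
    nlinarith [norm_nonneg d]
  have hF : Integrable (Function.uncurry fun (x ξ : E) =>
      φ ξ * (Complex.exp (imInner ((2 * Real.pi) • ξ) x) - 1)) (τ.prod volume) := by
    refine (hτ.mul_prod (hφ.integrable_one_add (2 * (2 * Real.pi)))).mono'
      (Continuous.aestronglyMeasurable ?_) (Eventually.of_forall fun p => ?_)
    · simp only [Function.uncurry_def]
      fun_prop
    · simp only [Function.uncurry_def, norm_mul]
      calc _ ≤ ‖φ p.2‖ * ((2 + ‖(2 * Real.pi) • p.2‖) * min 1 ‖p.1‖) := by
            gcongr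
            exact norm_exp_imInner_sub_one_le _ _
        _ ≤ ‖φ p.2‖ * ((2 * (2 * Real.pi) * (1 + ‖p.2‖)) * min 1 ‖p.1‖) := by
            gcongr
            refine le_trans ?_ (hgrow zero_le_two p.2)
            linarith [norm_nonneg ((2 * Real.pi) • p.2)]
        _ = _ := by ring
  have hinner : ∀ x, ∫ ξ, φ ξ * (Complex.exp (imInner ((2 * Real.pi) • ξ) x) - 1) = (u x : ℂ) := by
    intro x
    simp_rw [mul_sub, mul_one]
    rw [integral_sub _ hφ.integrable, hφ0, sub_zero, ← hφ.eq, hg]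
    refine hφ.integrable.norm.mono' (Continuous.aestronglyMeasurable (by fun_prop))
      (Eventually.of_forall fun ξ => ?_)
    rw [norm_mul, norm_exp_imInner, mul_one]
  have hswap := integral_integral_swap hF
  -- Removing the drift part `h2` from the cumulant identity `h1` leaves the jump part, which Fubini
  -- identifies with `∫ u dτ`.
  have hzero : ∫ x, (u x : ℂ) ∂τ = 0 := by
    simp_rw [hinner] at hswap
    rw [hswap]
    have h4 : ∀ ξ, ∫ x, φ ξ * (Complex.exp (imInner ((2 * Real.pi) • ξ) x) - 1) ∂τ
        = φ ξ * cumulant d τ (imInner ((2 * Real.pi) • ξ))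
          - φ ξ * imInner ((2 * Real.pi) • ξ) d := fun ξ => by
      rw [integral_const_mul, cumulant]
      ring
    simp_rw [h4]
    rw [integral_sub hint1 hint2, h1, h2, sub_zero]
  have hu0 : ∀ x, 0 ≤ u x := fun x => (hu5 ⟨x, rfl⟩).1
  -- As `u` is the inner integral of the function in `hF`, its `τ`-integrability comes from Fubini
  -- as well.
  have hint : Integrable u τ := by
    have h6 := hF.integral_prod_left
    simp only [Function.uncurry_def, hinner] at h6
    simpa using h6.re
  rw [integral_complex_ofReal, Complex.ofReal_eq_zero, integral_eq_zero_iff_of_nonneg hu0 hint] at hzero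
  refine ⟨{x | u x ≠ 0}, mem_nhdsWithin_of_mem_nhds ?_, hzero⟩
  exact (isOpen_ne_fun hu3.continuous continuous_const).mem_nhds (by simp [hu4])

end Support

/-! ### The law of `X` at a multivariate time, and joint measurability -/

section Evaluation

variable {n : ℕ} {Ω : Type*} [MeasurableSpace Ω]

/-- The cone `{0 ≤ s₁ ≤ … ≤ sₙ}`. -/
def monotoneCone (n : ℕ) : Set (EuclideanSpace ℝ (Fin n)) :=
  {s | (∀ k, 0 ≤ s k) ∧ Monotone fun k => s k}

lemma isClosed_monotoneCone : IsClosed (monotoneCone n) := by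
  have h : monotoneCone n = (⋂ k, {s | 0 ≤ s k}) ∩ ⋂ (k) (l) (_ : k ≤ l), {s | s k ≤ s l} := by
    ext s
    simp [monotoneCone, Monotone]
  rw [h]
  refine (isClosed_iInter fun k => isClosed_le (by fun_prop) (by fun_prop)).inter
    (isClosed_iInter fun k => isClosed_iInter fun l => isClosed_iInter fun _ =>
      isClosed_le (by fun_prop) (by fun_prop))

lemma zero_mem_monotoneCone : (0 : EuclideanSpace ℝ (Fin n)) ∈ monotoneCone n :=
  ⟨fun _ => le_rfl, fun _ _ _ => le_rfl⟩

lemma smul_mem_monotoneCone (c : ℝ) (hc : 0 < c) (s : EuclideanSpace ℝ (Fin n))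
    (hs : s ∈ monotoneCone n) : c • s ∈ monotoneCone n :=
  ⟨fun k => mul_nonneg hc.le (hs.1 k), fun _ _ h => mul_le_mul_of_nonneg_left (hs.2 h) hc.le⟩

/-- The functional `s ↦ s_j - s_{j-1}`, where `s_0 = 0`. -/
def increment (j : Fin n) : EuclideanSpace ℝ (Fin n) →L[ℝ] ℝ :=
  EuclideanSpace.proj j - if (j : ℕ) = 0 then 0 else
    EuclideanSpace.proj (⟨(j : ℕ) - 1, by have := j.isLt; omega⟩ : Fin n)

lemma increment_apply (j : Fin n) (s : EuclideanSpace ℝ (Fin n)) :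
    increment j s = s j - if (j : ℕ) = 0 then 0 else
      s ⟨(j : ℕ) - 1, by have := j.isLt; omega⟩ := by
  unfold increment
  split_ifs <;> simp

/-- Padding `s` with a leading `0` removes the case distinction at the first index, so that sums of
increments telescope. -/
lemma increment_eq_cons_sub (j : Fin n) (s : EuclideanSpace ℝ (Fin n)) :
    increment j s = (Fin.cons 0 s : Fin (n + 1) → ℝ) j.succ
      - (Fin.cons 0 s : Fin (n + 1) → ℝ) j.castSucc := by
  rw [increment_apply]
  cases n with
  | zero => exact j.elim0
  | succ n =>
    refine Fin.cases ?_ (fun i => ?_) j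
    · simp
    · rw [Fin.castSucc_succ, Fin.cons_succ, Fin.cons_succ]
      simp only [Fin.val_succ, Nat.add_eq_zero_iff, one_ne_zero, and_false, if_false]
      rfl

lemma increment_nonneg {s : EuclideanSpace ℝ (Fin n)} (hs : s ∈ monotoneCone n) (j : Fin n) :
    0 ≤ increment j s := by
  rw [increment_apply]
  split_ifs with h
  · simpa using hs.1 j
  · exact sub_nonneg.2 (hs.2 (Fin.mk_le_of_le_val (Nat.sub_le _ _)))

lemma inner_proj {ι : Type*} [Fintype ι] (J : Set ι) (x y : EuclideanSpace ℝ ι) :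
    inner ℝ (proj J x) y = inner ℝ x (proj J y) := by
  simp only [PiLp.inner_apply, proj]
  refine Finset.sum_congr rfl fun i _ => ?_
  by_cases hi : i ∈ J <;> simp [hi]

lemma measurable_proj {ι : Type*} [Fintype ι] (J : Set ι) :
    Measurable (proj J : EuclideanSpace ℝ ι → EuclideanSpace ℝ ι) := by
  refine (WithLp.measurable_toLp 2 _).comp (measurable_pi_lambda _ fun k => ?_)
  by_cases hk : k ∈ J
  · simp only [Set.indicator_of_mem hk]
    fun_prop
  · simp only [Set.indicator_of_notMem hk]
    fun_prop

lemma norm_proj_le {ι : Type*} [Fintype ι] (J : Set ι) (x : EuclideanSpace ℝ ι) :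
    ‖proj J x‖ ≤ ‖x‖ := by
  rw [EuclideanSpace.norm_eq, EuclideanSpace.norm_eq]
  refine Real.sqrt_le_sqrt (Finset.sum_le_sum fun i _ => ?_)
  simp only [proj]
  by_cases hi : i ∈ J <;> simp [hi, sq_nonneg]

lemma charFun_eq_integral_imInner {E : Type*} [NormedAddCommGroup E] [InnerProductSpace ℝ E]
    [FiniteDimensional ℝ E] [MeasurableSpace E] [BorelSpace E] (ρ : Measure E) (θ : E) :
    charFun ρ θ = ∫ x, Complex.exp (imInner θ x) ∂ρ := by
  rw [charFun_apply]
  congr with x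
  rw [imInner_apply, real_inner_comm, mul_comm]

/-- The exponent of the law of `X(s)` as a linear function of `s` in the monotone cone. -/
def diamondExponent (μ : EuclideanSpace ℝ (Fin n)) (C : Matrix (Fin n) (Fin n) ℝ)
    (ν : Measure (EuclideanSpace ℝ (Fin n))) (θ : EuclideanSpace ℝ (Fin n)) :
    EuclideanSpace ℝ (Fin n) →L[ℝ] ℂ :=
  ∑ j, levyExponent μ C ν (proj (Set.Ici j) θ) • (Complex.ofRealCLM ∘L increment j)

lemma diamondExponent_apply (μ : EuclideanSpace ℝ (Fin n)) (C : Matrix (Fin n) (Fin n) ℝ)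
    (ν : Measure (EuclideanSpace ℝ (Fin n))) (θ s : EuclideanSpace ℝ (Fin n)) :
    diamondExponent μ C ν θ s
      = ∑ j, (increment j s : ℂ) * levyExponent μ C ν (proj (Set.Ici j) θ) := by
  simp [diamondExponent, mul_comm]

lemma sum_Iic_succ_sub_castSucc {A : Type*} [AddCommGroup A] (f : Fin (n + 1) → A) (k : Fin n) :
    ∑ j with j ≤ k, (f j.succ - f j.castSucc) = f k.succ - f 0 := by
  induction n with
  | zero => exact k.elim0
  | succ n ih =>
    rw [Finset.sum_filter, Fin.sum_univ_succ]
    refine Fin.cases ?_ (fun i => ?_) k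
    · simp
    · have h := ih (fun j => f j.succ) i
      rw [Finset.sum_filter] at h
      simp only [Fin.succ_le_succ_iff, Fin.zero_le, if_true, ← Fin.succ_castSucc] at h ⊢
      rw [h]
      simp

variable {P : Measure Ω} {X : ℝ≥0 → Ω → EuclideanSpace ℝ (Fin n)}

lemma measurable_evalAt (hX : ∀ t, Measurable (X t)) (s : EuclideanSpace ℝ (Fin n)) :
    Measurable (evalAt X s) := by
  refine (WithLp.measurable_toLp 2 _).comp (measurable_pi_lambda _ fun k => ?_)
  have := hX (s k).toNNReal
  fun_prop

lemma charFun_map_proj (Y : Ω → EuclideanSpace ℝ (Fin n)) (hY : AEMeasurable Y P) (J : Set (Fin n))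
    (θ : EuclideanSpace ℝ (Fin n)) :
    charFun (P.map fun ω => proj J (Y ω)) θ = charFun (P.map Y) (proj J θ) := by
  have h : AEMeasurable (fun ω => proj J (Y ω)) P := (measurable_proj J).comp_aemeasurable hY
  rw [charFun_apply, charFun_apply, integral_map h (by fun_prop), integral_map hY (by fun_prop)]
  simp only [inner_proj]

/-- The characteristic function of `X(s)` for `s` in the monotone cone. -/
theorem integral_exp_imInner_evalAt [IsProbabilityMeasure P] {μ : EuclideanSpace ℝ (Fin n)}
    {C : Matrix (Fin n) (Fin n) ℝ} {ν : Measure (EuclideanSpace ℝ (Fin n))}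
    (hX : HasTriplet X P μ C ν) {s : EuclideanSpace ℝ (Fin n)} (hs : s ∈ monotoneCone n)
    (θ : EuclideanSpace ℝ (Fin n)) :
    ∫ ω, Complex.exp (imInner θ (evalAt X s ω)) ∂P = Complex.exp (diamondExponent μ C ν θ s) := by
  have hXm := hX.isLevyProcess.measurable
  set t : Fin (n + 1) → ℝ≥0 := Fin.cons 0 fun k => (s k).toNNReal with ht
  have ht0 : t 0 = 0 := rfl
  have htk : ∀ k : Fin n, t k.succ = (s k).toNNReal := fun k => rfl
  have htc : ∀ k, (t k : ℝ) = (Fin.cons 0 s : Fin (n + 1) → ℝ) k := by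
    refine Fin.cases ?_ fun k => ?_
    · simp [ht0]
    · rw [htk, Fin.cons_succ, Real.coe_toNNReal _ (hs.1 k)]
  have hinc : ∀ j : Fin n, increment j s = (t j.succ : ℝ) - t j.castSucc := fun j => by
    rw [htc, htc, increment_eq_cons_sub]
  have hle : ∀ j : Fin n, t j.castSucc ≤ t j.succ := fun j => by
    rw [← NNReal.coe_le_coe]
    linarith [hinc j, increment_nonneg hs j]
  have htm : Monotone t := Fin.monotone_iff_le_succ.2 hle
  set Y : Fin n → Ω → EuclideanSpace ℝ (Fin n) := fun j ω =>
    proj (Set.Ici j) (X (t j.succ) ω - X (t j.castSucc) ω)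
  have hYm : ∀ j, Measurable (Y j) := fun j =>
    (measurable_proj _).comp ((hXm _).sub (hXm _))
  have hYi : iIndepFun Y P := (hX.isLevyProcess.indep n t htm).comp _ fun j => measurable_proj _
  -- Coordinate `k` survives in `Y j` exactly for `j ≤ k`, so the sum telescopes to the `k`-th
  -- coordinate of `X(s_k) - X(0)`.
  have hsum : ∀ᵐ ω ∂P, evalAt X s ω = ∑ j, Y j ω := by
    filter_upwards [hX.isLevyProcess.zero] with ω hω
    ext k
    have h := sum_Iic_succ_sub_castSucc (fun j => X (t j) ω k) k
    rw [ht0, hω, htk] at h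
    simp only [PiLp.zero_apply, sub_zero] at h
    rw [WithLp.ofLp_sum, Finset.sum_apply]
    simp only [evalAt]
    rw [← h, Finset.sum_filter]
    refine Finset.sum_congr rfl fun j _ => ?_
    simp only [Y, proj, Set.indicator_apply, Set.mem_Ici, PiLp.sub_apply]
  have hY1 : ∀ j, charFun (P.map (Y j)) θ
      = Complex.exp (increment j s * levyExponent μ C ν (proj (Set.Ici j) θ)) := by
    intro j
    have h := (hX.isLevyProcess.stationary (t j.castSucc) (t j.succ - t j.castSucc)).map_eq
    rw [add_tsub_cancel_of_le (hle j)] at h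
    have h' := charFun_map_proj (P := P) (fun ω => X (t j.succ) ω - X (t j.castSucc) ω)
      ((hXm _).sub (hXm _)).aemeasurable (Set.Ici j) θ
    rw [h, hX.charFun_eq, NNReal.coe_sub (hle j), ← hinc] at h'
    exact h'
  calc ∫ ω, Complex.exp (imInner θ (evalAt X s ω)) ∂P
      = ∫ ω, Complex.exp (imInner θ (∑ j, Y j ω)) ∂P := by
        refine integral_congr_ae ?_
        filter_upwards [hsum] with ω hω
        rw [hω]
    _ = charFun (P.map fun ω => ∑ j, Y j ω) θ := by
        rw [charFun_eq_integral_imInner, integral_map (by fun_prop) (by fun_prop)]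
    _ = ∏ j, charFun (P.map (Y j)) θ := by
        rw [hYi.charFun_map_fun_sum_eq_prod fun j => (hYm j).aemeasurable]
        simp
    _ = _ := by
        rw [diamondExponent_apply, Complex.exp_sum]
        exact Finset.prod_congr rfl fun j _ => hY1 j

/-- Its exponential is a value of a characteristic function, hence of modulus at most one. -/
lemma diamondExponent_re_nonpos [IsProbabilityMeasure P] {μ : EuclideanSpace ℝ (Fin n)}
    {C : Matrix (Fin n) (Fin n) ℝ} {ν : Measure (EuclideanSpace ℝ (Fin n))}
    (hX : HasTriplet X P μ C ν) {s : EuclideanSpace ℝ (Fin n)} (hs : s ∈ monotoneCone n)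
    (θ : EuclideanSpace ℝ (Fin n)) : (diamondExponent μ C ν θ s).re ≤ 0 := by
  rw [← Real.exp_le_one_iff, ← Complex.norm_exp, ← integral_exp_imInner_evalAt hX hs]
  refine (norm_integral_le_of_norm_le_const (C := 1) (Eventually.of_forall fun ω => ?_)).trans
    (by simp)
  rw [norm_exp_imInner]

/-- Rounding up to the grid of mesh `1 / (m + 1)`, coordinatewise. -/
def roundUp (m : ℕ) (s : EuclideanSpace ℝ (Fin n)) : EuclideanSpace ℝ (Fin n) :=
  WithLp.toLp 2 fun k => (((⌊(m + 1 : ℝ≥0) * (s k).toNNReal⌋₊ + 1 : ℝ≥0) / (m + 1) : ℝ≥0) : ℝ)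

lemma toNNReal_roundUp (m : ℕ) (s : EuclideanSpace ℝ (Fin n)) (k : Fin n) :
    (roundUp m s k).toNNReal = (⌊(m + 1 : ℝ≥0) * (s k).toNNReal⌋₊ + 1 : ℝ≥0) / (m + 1) :=
  Real.toNNReal_coe

lemma roundUp_mem_monotoneCone (m : ℕ) {s : EuclideanSpace ℝ (Fin n)} (hs : s ∈ monotoneCone n) :
    roundUp m s ∈ monotoneCone n := by
  refine ⟨fun k => NNReal.coe_nonneg _, fun k l hkl => NNReal.coe_le_coe.2 ?_⟩
  gcongr
  exact hs.2 hkl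

lemma measurable_roundUp (m : ℕ) : Measurable (roundUp (n := n) m) := by
  have h : Measurable fun s : EuclideanSpace ℝ (Fin n) => fun k : Fin n =>
      (((⌊(m + 1 : ℝ≥0) * (s k).toNNReal⌋₊ + 1 : ℝ≥0) / (m + 1) : ℝ≥0) : ℝ) := by
    refine measurable_pi_lambda _ fun k => ?_
    have h1 : Measurable fun s : EuclideanSpace ℝ (Fin n) => (m + 1 : ℝ≥0) * (s k).toNNReal := by
      fun_prop
    have h3 : Measurable fun i : ℕ => ((((i : ℝ≥0) + 1) / (m + 1) : ℝ≥0) : ℝ) :=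
      measurable_from_top
    exact h3.comp (Nat.measurable_floor.comp h1)
  exact (WithLp.measurable_toLp 2 _).comp h

/-- Adding one to the floor moves every time to the right, so the grid approximates from the side on
which càdlàg paths are continuous. -/
lemma lt_toNNReal_roundUp (m : ℕ) (s : EuclideanSpace ℝ (Fin n)) (k : Fin n) :
    (s k).toNNReal < (roundUp m s k).toNNReal := by
  rw [toNNReal_roundUp, lt_div_iff₀ (by positivity), mul_comm]
  exact Nat.lt_floor_add_one _

lemma tendsto_toNNReal_roundUp (s : EuclideanSpace ℝ (Fin n)) (k : Fin n) :
    Tendsto (fun m => (roundUp m s k).toNNReal) atTop (𝓝 (s k).toNNReal) := by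
  have h : Tendsto (fun m : ℕ => (s k).toNNReal + 1 / ((m : ℝ≥0) + 1)) atTop
      (𝓝 ((s k).toNNReal + 0)) :=
    tendsto_const_nhds.add tendsto_one_div_add_atTop_nhds_zero_nat
  rw [add_zero] at h
  refine tendsto_of_tendsto_of_tendsto_of_le_of_le tendsto_const_nhds h
    (fun m => (lt_toNNReal_roundUp m s k).le) fun m => ?_
  rw [toNNReal_roundUp, add_div]
  gcongr
  rw [div_le_iff₀ (by positivity), mul_comm]
  exact Nat.floor_le zero_le

lemma tendsto_roundUp {s : EuclideanSpace ℝ (Fin n)} (hs : ∀ k, 0 ≤ s k) :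
    Tendsto (fun m => roundUp m s) atTop (𝓝 s) := by
  have h : Tendsto (fun m => WithLp.ofLp (roundUp m s)) atTop (𝓝 (WithLp.ofLp s)) := by
    refine tendsto_pi_nhds.2 fun k => ?_
    have h1 := (NNReal.continuous_coe.tendsto _).comp (tendsto_toNNReal_roundUp s k)
    rw [Real.coe_toNNReal _ (hs k)] at h1
    refine h1.congr fun m => ?_
    exact Real.coe_toNNReal _ (NNReal.coe_nonneg _)
  exact ((PiLp.continuous_toLp 2 _).tendsto _).comp h

lemma tendsto_evalAt_roundUp {ω : Ω} (hω : IsCadlag fun t => X t ω)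
    (s : EuclideanSpace ℝ (Fin n)) :
    Tendsto (fun m => evalAt X (roundUp m s) ω) atTop (𝓝 (evalAt X s ω)) := by
  have h : Tendsto (fun m k => X (roundUp m s k).toNNReal ω k) atTop
      (𝓝 fun k => X (s k).toNNReal ω k) := by
    refine tendsto_pi_nhds.2 fun k => ?_
    have h1 : Tendsto (fun m => X (roundUp m s k).toNNReal ω) atTop
        (𝓝 (X (s k).toNNReal ω)) :=
      (hω.1 (s k).toNNReal).tendsto.comp (tendsto_nhdsWithin_iff.2
        ⟨tendsto_toNNReal_roundUp s k,
          Eventually.of_forall fun m => (lt_toNNReal_roundUp m s k).le⟩)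
    have h2 : Continuous fun x : EuclideanSpace ℝ (Fin n) => x k := by fun_prop
    exact (h2.tendsto _).comp h1
  exact ((PiLp.continuous_toLp 2 _).tendsto _).comp h

/-- Rounded times take countably many values, so measurability in `ω` at each fixed time suffices.
No path regularity enters, and the lemma also applies to the coordinate process on the full path
space. -/
lemma measurable_evalAt_roundUp (hX : ∀ t, Measurable (X t)) (m : ℕ) :
    Measurable fun p : EuclideanSpace ℝ (Fin n) × Ω => evalAt X (roundUp m p.1) p.2 := by
  have h : Measurable fun p : EuclideanSpace ℝ (Fin n) × Ω =>
      fun k => X (roundUp m p.1 k).toNNReal p.2 k := by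
    refine measurable_pi_lambda _ fun k => ?_
    have h1 : Measurable fun q : ℕ × Ω => X (((q.1 : ℝ≥0) + 1) / (m + 1)) q.2 k := by
      refine measurable_from_prod_countable_right fun i => ?_
      have h : Measurable fun x : EuclideanSpace ℝ (Fin n) => x k := by fun_prop
      exact h.comp (hX (((i : ℝ≥0) + 1) / (m + 1)))
    have h2 : Measurable fun p : EuclideanSpace ℝ (Fin n) × Ω =>
        (⌊(m + 1 : ℝ≥0) * (p.1 k).toNNReal⌋₊, p.2) := by
      refine Measurable.prodMk (Nat.measurable_floor.comp ?_) measurable_snd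
      fun_prop
    have h3 := h1.comp h2
    simp only [toNNReal_roundUp]
    exact h3
  exact (WithLp.measurable_toLp 2 _).comp h

/-- The evaluation of a càdlàg process at multivariate times has a jointly measurable version. -/
theorem exists_measurable_evalAt (hX : IsLevyProcess X P) :
    ∃ Y : EuclideanSpace ℝ (Fin n) → Ω → EuclideanSpace ℝ (Fin n),
      Measurable (Function.uncurry Y) ∧ ∀ᵐ ω ∂P, ∀ s, evalAt X s ω = Y s ω := by
  classical
  -- Paths that fail to be càdlàg lie in a measurable null set `N`, where the version is set to
  -- zero; elsewhere it is the limit of the rounded evaluations.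
  obtain ⟨N, hN, hNm, hN0⟩ := exists_measurable_superset_of_null (ae_iff.1 hX.cadlag)
  refine ⟨fun s ω => if ω ∈ N then 0 else evalAt X s ω, ?_, ?_⟩
  · refine measurable_of_tendsto_metrizable
      (f := fun m p => if p.2 ∈ N then 0 else evalAt X (roundUp m p.1) p.2) (fun m => ?_)
      (tendsto_pi_nhds.2 fun p => ?_)
    · exact Measurable.ite (measurable_snd hNm) measurable_const
        (measurable_evalAt_roundUp hX.measurable m)
    · simp only [Function.uncurry_def]
      split_ifs with hp
      · exact tendsto_const_nhds
      · exact tendsto_evalAt_roundUp (not_not.1 fun h => hp (hN h)) _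
  · filter_upwards [measure_eq_zero_iff_ae_notMem.1 hN0] with ω hω s
    rw [if_neg hω]

end Evaluation

/-! ### Lévy–Khintchine formula for finite variation processes -/

section Subordinator

variable {ι : Type*} [Fintype ι] {Ω : Type*} [MeasurableSpace Ω]

lemma IsLevyMeasure.integrable_min {ν : Measure (EuclideanSpace ℝ ι)} (hν : IsLevyMeasure ν) :
    Integrable (fun x => min (‖x‖ ^ 2) 1) ν := by
  refine ⟨Continuous.aestronglyMeasurable (by fun_prop), ?_⟩
  rw [hasFiniteIntegral_iff_ofReal (Eventually.of_forall fun x => by positivity)]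
  exact hν.lintegral_lt_top

/-- The integrable function `min(‖x‖², 1)` is positive off the origin, so its superlevel sets
exhaust the punctured space by sets of finite measure. -/
lemma IsLevyMeasure.sigmaFinite {ν : Measure (EuclideanSpace ℝ ι)} (hν : IsLevyMeasure ν) :
    SigmaFinite ν := by
  refine Measure.sigmaFinite_of_countable (S := insert {0}
    (Set.range fun m : ℕ => {x | 1 / ((m : ℝ) + 1) ≤ min (‖x‖ ^ 2) 1}))
    ((Set.countable_range _).insert _) ?_ ?_
  · rintro s (rfl | ⟨m, rfl⟩)
    · simp [hν.zero]
    · exact hν.integrable_min.measure_ge_lt_top (by positivity)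
  · refine Set.eq_univ_of_forall fun x => ?_
    by_cases hx : x = 0
    · exact ⟨{0}, Set.mem_insert _ _, hx⟩
    · have hpos : 0 < min (‖x‖ ^ 2) 1 := lt_min (by positivity) one_pos
      obtain ⟨m, hm⟩ := exists_nat_one_div_lt hpos
      exact ⟨_, Set.mem_insert_of_mem _ ⟨m, rfl⟩, hm.le⟩

lemma integrable_min_of_isFiniteVariation {T : ℝ≥0 → Ω → EuclideanSpace ℝ ι} {P : Measure Ω}
    {d : EuclideanSpace ℝ ι} {τ : Measure (EuclideanSpace ℝ ι)} (hT : IsFiniteVariation T P d τ) :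
    Integrable (fun x => min 1 ‖x‖) τ := by
  obtain ⟨γ, hγ, hint, -⟩ := hT
  have hm : MeasurableSet (Metric.closedBall (0 : EuclideanSpace ℝ ι) 1 \ {0}) :=
    measurableSet_closedBall.diff (measurableSet_singleton 0)
  refine (((integrable_indicator_iff hm).2 hint.norm).add hγ.isLevyMeasure.integrable_min).mono'
    (Continuous.aestronglyMeasurable (by fun_prop)) (Eventually.of_forall fun x => ?_)
  rw [Real.norm_of_nonneg (by positivity), Pi.add_apply]
  by_cases hx : x ∈ Metric.closedBall (0 : EuclideanSpace ℝ ι) 1 \ {0}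
  · rw [Set.indicator_of_mem hx]
    have h1 : 0 ≤ min (‖x‖ ^ 2) 1 := le_min (sq_nonneg _) zero_le_one
    linarith [min_le_right 1 ‖x‖]
  · rw [Set.indicator_of_notMem hx, zero_add]
    by_cases h0 : x = 0
    · simp [h0]
    · have h1 : 1 < ‖x‖ := by
        by_contra! h
        exact hx ⟨mem_closedBall_zero_iff.2 h, h0⟩
      rw [min_eq_left h1.le, min_eq_right (by nlinarith)]

/-- Finite variation makes the truncation term integrable on its own, so it can be split off and
absorbed into `γ`, leaving `d`. -/
lemma levyExponent_eq_cumulant {γ d : EuclideanSpace ℝ ι} {τ : Measure (EuclideanSpace ℝ ι)}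
    (hτ : Integrable (fun x => min 1 ‖x‖) τ)
    (hint : IntegrableOn (fun x => x) (Metric.closedBall 0 1 \ {0}) τ)
    (hd : d = γ - ∫ x in Metric.closedBall 0 1 \ {0}, x ∂τ) (θ : EuclideanSpace ℝ ι) :
    levyExponent γ 0 τ θ = cumulant d τ (imInner θ) := by
  have hm : MeasurableSet (Metric.closedBall (0 : EuclideanSpace ℝ ι) 1 \ {0}) :=
    measurableSet_closedBall.diff (measurableSet_singleton 0)
  have hind : (Metric.closedBall (0 : EuclideanSpace ℝ ι) 1).indicator (fun y => inner ℝ θ y)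
      = (Metric.closedBall (0 : EuclideanSpace ℝ ι) 1 \ {0}).indicator
        (fun y => inner ℝ θ y) := by
    ext x
    by_cases h0 : x = 0
    · simp [h0]
    · by_cases hx : x ∈ Metric.closedBall (0 : EuclideanSpace ℝ ι) 1
      · rw [Set.indicator_of_mem hx, Set.indicator_of_mem (Set.mem_sdiff_singleton.2 ⟨hx, h0⟩)]
      · rw [Set.indicator_of_notMem hx, Set.indicator_of_notMem fun h => hx h.1]
  have hint' : Integrable (fun x => (((Metric.closedBall (0 : EuclideanSpace ℝ ι) 1 \ {0}).indicator
      (fun y => inner ℝ θ y) x : ℝ) : ℂ)) τ :=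
    Integrable.ofReal ((integrable_indicator_iff (f := fun y => inner ℝ θ y) hm).2
      (Integrable.const_inner (𝕜 := ℝ) θ hint))
  have hexp := integrable_exp_imInner_sub_one hτ θ
  simp only [imInner_apply] at hexp
  have hsplit := integral_sub hexp (hint'.const_mul Complex.I)
  rw [integral_const_mul, integral_complex_ofReal, integral_indicator hm,
    integral_inner hint] at hsplit
  unfold levyExponent
  rw [hind, hsplit, cumulant, hd]
  simp only [imInner_apply, inner_sub_right]
  rw [real_inner_comm θ γ]
  simp
  ring

lemma charFun_isFiniteVariation {T : ℝ≥0 → Ω → EuclideanSpace ℝ ι} {P : Measure Ω}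
    {d : EuclideanSpace ℝ ι} {τ : Measure (EuclideanSpace ℝ ι)} (hT : IsFiniteVariation T P d τ)
    (t : ℝ≥0) (θ : EuclideanSpace ℝ ι) :
    ∫ x, Complex.exp (imInner θ x) ∂P.map (T t)
      = Complex.exp ((t : ℝ) * cumulant d τ (imInner θ)) := by
  have hτ := integrable_min_of_isFiniteVariation hT
  obtain ⟨γ, hγ, hint, hd⟩ := hT
  rw [← levyExponent_eq_cumulant hτ hint hd, ← charFun_eq_integral_imInner,
    hγ.charFun_eq]

end Subordinator

/-! ### Conditioning on an independent time with monotone components -/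

section Monotone

variable {n : ℕ} {Ω : Type*} [MeasurableSpace Ω] {P : Measure Ω}
  {X T : ℝ≥0 → Ω → EuclideanSpace ℝ (Fin n)} {μ : EuclideanSpace ℝ (Fin n)}
  {C : Matrix (Fin n) (Fin n) ℝ} {ν : Measure (EuclideanSpace ℝ (Fin n))}
  {d : EuclideanSpace ℝ (Fin n)} {τ : Measure (EuclideanSpace ℝ (Fin n))}

lemma IsSubordinator.isLevyProcess (hT : IsSubordinator T P d τ) : IsLevyProcess T P := by
  obtain ⟨γ, hγ, -⟩ := hT.isFiniteVariation
  exact hγ.isLevyProcess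

lemma IsSubordinator.isLevyMeasure (hT : IsSubordinator T P d τ) : IsLevyMeasure τ := by
  obtain ⟨γ, hγ, -⟩ := hT.isFiniteVariation
  exact hγ.isLevyMeasure

lemma IsSubordinator.ae_mem_monotoneCone (hT : IsSubordinator T P d τ)
    (hmono : ∀ᵐ ω ∂P, ∀ t, Monotone (fun k : Fin n => T t ω k)) (t : ℝ≥0) :
    ∀ᵐ ω ∂P, T t ω ∈ monotoneCone n := by
  filter_upwards [hT.monotone, hmono, hT.isLevyProcess.zero] with ω h1 h2 h3
  refine ⟨fun k => ?_, h2 t⟩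
  have h := h1 k (zero_le (a := t))
  simpa [h3] using h

lemma IsSubordinator.ae_map_mem_monotoneCone (hT : IsSubordinator T P d τ)
    (hmono : ∀ᵐ ω ∂P, ∀ t, Monotone (fun k : Fin n => T t ω k)) (t : ℝ≥0) :
    ∀ᵐ s ∂P.map (T t), s ∈ monotoneCone n :=
  (ae_map_iff (hT.isLevyProcess.measurable t).aemeasurable
    isClosed_monotoneCone.measurableSet).2 (hT.ae_mem_monotoneCone hmono t)

variable [IsProbabilityMeasure P]

lemma IsSubordinator.drift_mem_monotoneCone (hT : IsSubordinator T P d τ)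
    (hmono : ∀ᵐ ω ∂P, ∀ t, Monotone (fun k : Fin n => T t ω k)) : d ∈ monotoneCone n := by
  have hprob : ∀ s : ℝ, IsProbabilityMeasure (P.map (T s.toNNReal)) := fun s =>
    Measure.isProbabilityMeasure_map (hT.isLevyProcess.measurable _).aemeasurable
  refine drift_mem_of_ae_mem (integrable_min_of_isFiniteVariation hT.isFiniteVariation)
    (ρ := fun s => P.map (T s.toNNReal)) (fun s hs θ => ?_) isClosed_monotoneCone
    smul_mem_monotoneCone (fun s _ => hT.ae_map_mem_monotoneCone hmono _)
  rw [charFun_isFiniteVariation hT.isFiniteVariation, Real.coe_toNNReal _ hs.le]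

lemma IsSubordinator.levyMeasure_ae_mem_monotoneCone (hT : IsSubordinator T P d τ)
    (hmono : ∀ᵐ ω ∂P, ∀ t, Monotone (fun k : Fin n => T t ω k)) :
    ∀ᵐ s ∂τ, s ∈ monotoneCone n := by
  have hprob : ∀ s : ℝ, IsProbabilityMeasure (P.map (T s.toNNReal)) := fun s =>
    Measure.isProbabilityMeasure_map (hT.isLevyProcess.measurable _).aemeasurable
  have := hT.isLevyMeasure.sigmaFinite
  refine levyMeasure_ae_mem_of_ae_mem (d := d)
    (integrable_min_of_isFiniteVariation hT.isFiniteVariation)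
    (ρ := fun s => P.map (T s.toNNReal)) (fun s hs θ => ?_) isClosed_monotoneCone
    zero_mem_monotoneCone
    smul_mem_monotoneCone (fun s _ => hT.ae_map_mem_monotoneCone hmono _)
  rw [charFun_isFiniteVariation hT.isFiniteVariation, Real.coe_toNNReal _ hs.le]

/-- Since `τ` is carried by the monotone cone without the origin, the domain restrictions in the
weak triplet can be dropped. -/
lemma IsSubordinator.restrict_puncturedOrthant (hT : IsSubordinator T P d τ)
    (hmono : ∀ᵐ ω ∂P, ∀ t, Monotone (fun k : Fin n => T t ω k)) :
    τ.restrict (puncturedOrthant (Fin n)) = τ := by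
  refine Measure.restrict_eq_self_of_ae_mem ?_
  filter_upwards [hT.levyMeasure_ae_mem_monotoneCone hmono,
    measure_eq_zero_iff_ae_notMem.1 hT.isLevyMeasure.zero] with s h1 h2
  exact ⟨h1.1, h2⟩

/-- Conditioning on an independent random time: the integrated form of Fubini's theorem. -/
lemma integral_comp_indepFun {A B : Type*} [MeasurableSpace A] [MeasurableSpace B]
    {S : Ω → A} {Y : Ω → B} (hS : Measurable S) (hY : Measurable Y) (hSY : IndepFun S Y P)
    {G : A × B → ℂ} (hG : Measurable G) {c : ℝ} (hGc : ∀ p, ‖G p‖ ≤ c) :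
    ∫ ω, G (S ω, Y ω) ∂P = ∫ ω, ∫ ω', G (S ω, Y ω') ∂P ∂P := by
  have hprob1 : IsProbabilityMeasure (P.map S) := Measure.isProbabilityMeasure_map hS.aemeasurable
  have hprob2 : IsProbabilityMeasure (P.map Y) := Measure.isProbabilityMeasure_map hY.aemeasurable
  rw [← integral_map (hS.prodMk hY).aemeasurable (f := G) hG.aestronglyMeasurable,
    (indepFun_iff_map_prod_eq_prod_map_map hS.aemeasurable hY.aemeasurable).1 hSY,
    integral_prod _ ((integrable_const c).mono' hG.aestronglyMeasurable (Eventually.of_forall hGc)),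
    integral_map hS.aemeasurable hG.stronglyMeasurable.integral_prod_right'.aestronglyMeasurable]
  congr with ω
  rw [integral_map hY.aemeasurable (f := fun y => G (S ω, y))
    (hG.comp measurable_prodMk_left).aestronglyMeasurable]

/-- Independence concerns whole paths with the product σ-algebra, on which evaluation at a variable
time need not be jointly measurable. At rounded times it is, so Fubini applies there first. -/
lemma integral_exp_imInner_evalAt_roundUp (hX : HasTriplet X P μ C ν)
    {S : Ω → EuclideanSpace ℝ (Fin n)} (hS : Measurable S)
    (hSX : IndepFun S (fun ω (t : ℝ≥0) => X t ω) P) (hmem : ∀ᵐ ω ∂P, S ω ∈ monotoneCone n)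
    (θ₁ θ₂ : EuclideanSpace ℝ (Fin n)) (m : ℕ) :
    ∫ ω, Complex.exp (imInner θ₁ (S ω) + imInner θ₂ (evalAt X (roundUp m (S ω)) ω)) ∂P
      = ∫ ω, Complex.exp (imInner θ₁ (S ω) + diamondExponent μ C ν θ₂ (roundUp m (S ω))) ∂P := by
  have hpath : Measurable fun ω (t : ℝ≥0) => X t ω :=
    measurable_pi_lambda _ hX.isLevyProcess.measurable
  have hround : Measurable fun p : EuclideanSpace ℝ (Fin n) × (ℝ≥0 →
      EuclideanSpace ℝ (Fin n)) => evalAt (fun t x => x t) (roundUp m p.1) p.2 :=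
    measurable_evalAt_roundUp (fun t => measurable_pi_apply t) m
  have hG : Measurable fun p : EuclideanSpace ℝ (Fin n) × (ℝ≥0 → EuclideanSpace ℝ (Fin n)) =>
      Complex.exp (imInner θ₁ p.1
        + imInner θ₂ (evalAt (fun t x => x t) (roundUp m p.1) p.2)) := by
    fun_prop
  refine (integral_comp_indepFun hS hpath hSX hG (c := 1) fun p => ?_).trans ?_
  · simp only [Complex.exp_add, norm_mul, norm_exp_imInner, mul_one, le_refl]
  · refine integral_congr_ae ?_
    filter_upwards [hmem] with ω hω
    simp only [Complex.exp_add]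
    rw [← integral_exp_imInner_evalAt hX (roundUp_mem_monotoneCone m hω), ← integral_const_mul]
    rfl

/-- The transform of `(S, X(S))` at an independent random time `S` with values in the monotone
cone. -/
lemma integral_exp_imInner_evalAt_comp (hX : HasTriplet X P μ C ν)
    {S : Ω → EuclideanSpace ℝ (Fin n)} (hS : Measurable S)
    (hSX : IndepFun S (fun ω (t : ℝ≥0) => X t ω) P) (hmem : ∀ᵐ ω ∂P, S ω ∈ monotoneCone n)
    (θ₁ θ₂ : EuclideanSpace ℝ (Fin n)) :
    ∫ ω, Complex.exp (imInner θ₁ (S ω) + imInner θ₂ (evalAt X (S ω) ω)) ∂P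
      = ∫ s, Complex.exp ((imInner θ₁ + diamondExponent μ C ν θ₂) s) ∂P.map S := by
  have hXm := hX.isLevyProcess.measurable
  have hev : ∀ m, Measurable fun ω => evalAt X (roundUp m (S ω)) ω := fun m =>
    by
    have h := (measurable_evalAt_roundUp hXm m).comp (hS.prodMk measurable_id')
    exact h
  -- Rounding is removed on the left by right-continuity of the paths.
  have hlim1 : Tendsto (fun m : ℕ =>
      ∫ ω, Complex.exp (imInner θ₁ (S ω) + imInner θ₂ (evalAt X (roundUp m (S ω)) ω)) ∂P) atTop
      (𝓝 (∫ ω, Complex.exp (imInner θ₁ (S ω) + imInner θ₂ (evalAt X (S ω) ω)) ∂P)) := by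
    refine tendsto_integral_of_dominated_convergence (fun _ => 1) (fun m => ?_)
      (integrable_const _) (fun m => Eventually.of_forall fun ω => ?_) ?_
    · exact (Complex.measurable_exp.comp (((imInner θ₁).measurable.comp hS).add
        ((imInner θ₂).measurable.comp (hev m)))).aestronglyMeasurable
    · simp only [Complex.exp_add, norm_mul, norm_exp_imInner, mul_one, le_refl]
    · filter_upwards [hX.isLevyProcess.cadlag] with ω hω
      refine (Complex.continuous_exp.tendsto _).comp (tendsto_const_nhds.add ?_)
      exact ((imInner θ₂).continuous.tendsto _).comp (tendsto_evalAt_roundUp hω _)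
  -- Rounding is removed on the right by continuity of the linear exponent, bounded since rounding
  -- preserves the cone.
  have hlim2 : Tendsto (fun m : ℕ =>
      ∫ ω, Complex.exp (imInner θ₁ (S ω) + diamondExponent μ C ν θ₂ (roundUp m (S ω))) ∂P) atTop
      (𝓝 (∫ ω, Complex.exp (imInner θ₁ (S ω) + diamondExponent μ C ν θ₂ (S ω)) ∂P)) := by
    refine tendsto_integral_of_dominated_convergence (fun _ => 1) (fun m => ?_)
      (integrable_const _) (fun m => ?_) ?_
    · exact (Complex.measurable_exp.comp (((imInner θ₁).measurable.comp hS).add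
        ((diamondExponent μ C ν θ₂).measurable.comp
          ((measurable_roundUp m).comp hS)))).aestronglyMeasurable
    · filter_upwards [hmem] with ω hω
      rw [Complex.exp_add, norm_mul, norm_exp_imInner, one_mul]
      exact norm_exp_le_one (diamondExponent_re_nonpos hX (roundUp_mem_monotoneCone m hω) θ₂)
    · filter_upwards [hmem] with ω hω
      refine (Complex.continuous_exp.tendsto _).comp (tendsto_const_nhds.add ?_)
      exact ((diamondExponent μ C ν θ₂).continuous.tendsto _).comp (tendsto_roundUp hω.1)
  simp_rw [integral_exp_imInner_evalAt_roundUp hX hS hSX hmem] at hlim1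
  rw [tendsto_nhds_unique hlim1 hlim2, integral_map hS.aemeasurable (by fun_prop)]
  simp only [add_apply]

/-- The characteristic function of `(T(t), X(T(t)))`. -/
theorem integral_exp_subordinated (hX : HasTriplet X P μ C ν) (hT : IsSubordinator T P d τ)
    (hTX : IndepFun (fun ω (t : ℝ≥0) => T t ω) (fun ω (t : ℝ≥0) => X t ω) P)
    (hmono : ∀ᵐ ω ∂P, ∀ t, Monotone (fun k : Fin n => T t ω k)) (t : ℝ≥0)
    (θ₁ θ₂ : EuclideanSpace ℝ (Fin n)) :
    ∫ ω, Complex.exp (imInner θ₁ (T t ω) + imInner θ₂ (evalAt X (T t ω) ω)) ∂P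
      = Complex.exp ((t : ℝ) * cumulant d τ (imInner θ₁ + diamondExponent μ C ν θ₂)) := by
  have hTm := hT.isLevyProcess.measurable t
  have hprob : IsProbabilityMeasure (P.map (T t)) :=
    Measure.isProbabilityMeasure_map hTm.aemeasurable
  have hre : ∀ s ∈ monotoneCone n, ((imInner θ₁ + diamondExponent μ C ν θ₂) s).re ≤ 0 :=
    fun s hs => by
      rw [add_apply, Complex.add_re, imInner_re, zero_add]
      exact diamondExponent_re_nonpos hX hs θ₂
  rw [integral_exp_imInner_evalAt_comp hX hTm (hTX.comp (measurable_pi_apply t) measurable_id)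
    (hT.ae_mem_monotoneCone hmono t)]
  exact integral_exp_eq_exp_cumulant (integrable_min_of_isFiniteVariation hT.isFiniteVariation)
    t.coe_nonneg (charFun_isFiniteVariation hT.isFiniteVariation t)
    ((hT.ae_map_mem_monotoneCone hmono t).mono hre)
    ((hT.levyMeasure_ae_mem_monotoneCone hmono).mono hre) (hre d (hT.drift_mem_monotoneCone hmono))

end Monotone

/-! ### The Lévy integrand and its truncation -/

section Integrand

variable {ι : Type*} [Fintype ι]

/-- The integrand `exp(i⟨θ, x⟩) - 1 - i⟨θ, x⟩ 1_𝔻(x)` of the Lévy exponent. -/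
def levyIntegrand (θ x : EuclideanSpace ℝ ι) : ℂ :=
  Complex.exp (Complex.I * ((inner ℝ θ x : ℝ) : ℂ)) - 1
    - Complex.I * (((Metric.closedBall (0 : EuclideanSpace ℝ ι) 1).indicator
        (fun y => inner ℝ θ y) x : ℝ) : ℂ)

lemma levyIntegrand_zero (θ : EuclideanSpace ℝ ι) : levyIntegrand θ 0 = 0 := by
  simp [levyIntegrand]

lemma measurable_levyIntegrand (θ : EuclideanSpace ℝ ι) : Measurable (levyIntegrand θ) := by
  have h : Measurable ((Metric.closedBall (0 : EuclideanSpace ℝ ι) 1).indicator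
      (fun y => inner ℝ θ y)) :=
    Measurable.indicator (by fun_prop) measurableSet_closedBall
  unfold levyIntegrand
  fun_prop

/-- With `z = i⟨θ, x⟩` and `x` in the ball, the bound is `‖z‖²` if `‖z‖ ≤ 1` and `2 + ‖z‖ ≤ 3‖z‖²`
otherwise. Off the ball it is `2`. -/
lemma norm_levyIntegrand_le (θ x : EuclideanSpace ℝ ι) :
    ‖levyIntegrand θ x‖ ≤ (3 * ‖θ‖ ^ 2 + 2) * min (‖x‖ ^ 2) 1 := by
  unfold levyIntegrand
  rw [← imInner_apply]
  have h2 := norm_exp_sub_one_le_two (imInner_re θ x).le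
  by_cases hx : x ∈ Metric.closedBall (0 : EuclideanSpace ℝ ι) 1
  · have hx1 : ‖x‖ ≤ 1 := mem_closedBall_zero_iff.1 hx
    rw [Set.indicator_of_mem hx, ← imInner_apply, min_eq_left (by nlinarith [norm_nonneg x])]
    have h1 := norm_imInner_apply_le θ x
    have h3 : ‖imInner θ x‖ ^ 2 ≤ ‖θ‖ ^ 2 * ‖x‖ ^ 2 := by
      rw [← mul_pow]
      gcongr
    rcases le_total ‖imInner θ x‖ 1 with h | h
    · have := Complex.norm_exp_sub_one_sub_id_le h
      nlinarith [sq_nonneg ‖x‖, sq_nonneg ‖θ‖, mul_nonneg (sq_nonneg ‖θ‖) (sq_nonneg ‖x‖)]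
    · have := norm_sub_le (Complex.exp (imInner θ x) - 1) (imInner θ x)
      nlinarith [sq_nonneg ‖x‖, sq_nonneg ‖θ‖]
  · have hx1 : 1 < ‖x‖ := not_le.1 fun h => hx (mem_closedBall_zero_iff.2 h)
    rw [Set.indicator_of_notMem hx, min_eq_right (by nlinarith)]
    simp only [Complex.ofReal_zero, mul_zero, sub_zero]
    nlinarith [sq_nonneg ‖θ‖]

lemma integrable_levyIntegrand {ν : Measure (EuclideanSpace ℝ ι)}
    (hν : Integrable (fun x => min (‖x‖ ^ 2) 1) ν) (θ : EuclideanSpace ℝ ι) :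
    Integrable (levyIntegrand θ) ν :=
  (hν.const_mul _).mono' (measurable_levyIntegrand θ).aestronglyMeasurable
    (Eventually.of_forall (norm_levyIntegrand_le θ))

lemma integrable_levyIntegrand_proj {ν : Measure (EuclideanSpace ℝ ι)}
    (hν : Integrable (fun x => min (‖x‖ ^ 2) 1) ν) (J : Set ι) (θ : EuclideanSpace ℝ ι) :
    Integrable (fun x => levyIntegrand θ (proj J x)) ν := by
  refine (hν.const_mul (3 * ‖θ‖ ^ 2 + 2)).mono'
    ((measurable_levyIntegrand θ).comp (measurable_proj J)).aestronglyMeasurable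
    (Eventually.of_forall fun x => (norm_levyIntegrand_le θ _).trans ?_)
  gcongr
  exact norm_proj_le J x

/-- The integrand vanishes at the origin, so deleting the mass there changes nothing. -/
lemma integral_levyIntegrand_projMeasure (ν : Measure (EuclideanSpace ℝ ι)) (J : Set ι)
    (θ : EuclideanSpace ℝ ι) :
    ∫ x, levyIntegrand θ x ∂projMeasure J ν = ∫ x, levyIntegrand θ (proj J x) ∂ν := by
  rw [projMeasure, setIntegral_eq_integral_of_forall_compl_eq_zero, integral_map
    (measurable_proj J).aemeasurable (measurable_levyIntegrand θ).aestronglyMeasurable]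
  intro x hx
  rw [Set.mem_compl_iff, not_not, Set.mem_singleton_iff] at hx
  rw [hx, levyIntegrand_zero]

lemma integrable_levyIntegrand_projMeasure {ν : Measure (EuclideanSpace ℝ ι)}
    (hν : Integrable (fun x => min (‖x‖ ^ 2) 1) ν) (J : Set ι) (θ : EuclideanSpace ℝ ι) :
    Integrable (levyIntegrand θ) (projMeasure J ν) := by
  refine Integrable.mono_measure ?_ Measure.restrict_le_self
  exact (integrable_map_measure (measurable_levyIntegrand θ).aestronglyMeasurable
    (measurable_proj J).aemeasurable).2 (integrable_levyIntegrand_proj hν J θ)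

/-- Change of the truncation under a coordinate projection. -/
lemma integral_levyIntegrand_proj {ν : Measure (EuclideanSpace ℝ ι)}
    (hν : IsLevyMeasure ν) (J : Set ι) (θ : EuclideanSpace ℝ ι) :
    ∫ x, levyIntegrand (proj J θ) x ∂ν
      = ∫ x, levyIntegrand θ (proj J x) ∂ν
        + Complex.I * ((inner ℝ θ (∫ x in (Metric.closedBall 0 1)ᶜ,
          (Metric.closedBall 0 1).indicator (fun y => y) (proj J x) ∂ν) : ℝ) : ℂ) := by
  have hmin := hν.integrable_min
  set D := Metric.closedBall (0 : EuclideanSpace ℝ ι) 1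
  have hDm : MeasurableSet D := measurableSet_closedBall
  have hfin : ν Dᶜ < ∞ := by
    refine lt_of_le_of_lt (measure_mono fun x hx => ?_)
      (hmin.measure_ge_lt_top (ε := 1) one_pos)
    have hx1 : 1 < ‖x‖ := not_le.1 fun h => hx (mem_closedBall_zero_iff.2 h)
    have hx2 : 1 ≤ ‖x‖ ^ 2 := by nlinarith
    exact le_min hx2 le_rfl
  have hmeas : Measurable fun x => D.indicator (fun y => y) (proj J x) :=
    (Measurable.indicator measurable_id' hDm).comp (measurable_proj J)
  have hint : IntegrableOn (fun x => D.indicator (fun y => y) (proj J x)) Dᶜ ν := by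
    refine Measure.integrableOn_of_bounded hfin.ne hmeas.aestronglyMeasurable (M := 1)
      (Eventually.of_forall fun x => ?_)
    by_cases h : proj J x ∈ D
    · rw [Set.indicator_of_mem h]
      exact mem_closedBall_zero_iff.1 h
    · rw [Set.indicator_of_notMem h, norm_zero]
      exact zero_le_one
  have hint' : Integrable (fun x => ((Dᶜ.indicator (fun x => inner ℝ θ
      (D.indicator (fun y => y) (proj J x))) x : ℝ) : ℂ)) ν :=
    Integrable.ofReal ((integrable_indicator_iff
      (f := fun x => inner ℝ θ (D.indicator (fun y => y) (proj J x))) hDm.compl).2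
      (Integrable.const_inner (𝕜 := ℝ) θ hint))
  rw [← integral_inner hint, ← integral_indicator hDm.compl, ← integral_complex_ofReal,
    ← integral_const_mul, ← integral_add (integrable_levyIntegrand_proj hmin J θ)
      (hint'.const_mul _)]
  -- As projections contract, the two truncations differ only when `x` is outside the ball and its
  -- projection inside; that difference is the correction term.
  congr with x
  unfold levyIntegrand
  rw [inner_proj]
  by_cases hx : x ∈ D
  · have hpx : proj J x ∈ D :=
      mem_closedBall_zero_iff.2 ((norm_proj_le J x).trans (mem_closedBall_zero_iff.1 hx))
    rw [Set.indicator_of_mem hx, Set.indicator_of_mem hpx, Set.indicator_of_notMem (by simpa using hx),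
      inner_proj]
    simp
  · rw [Set.indicator_of_notMem hx, Set.indicator_of_mem (Set.mem_compl hx)]
    by_cases hpx : proj J x ∈ D
    · rw [Set.indicator_of_mem hpx, Set.indicator_of_mem hpx]
      simp
    · rw [Set.indicator_of_notMem hpx, Set.indicator_of_notMem hpx]
      simp

end Integrand

/-! ### The exponent of the drift part -/

section Drift

variable {n : ℕ} {d : EuclideanSpace ℝ (Fin n)}

/-- Sorting breaks ties by index, so it is the identity even if coordinates coincide. Spacings then
become increments, and upper sets final segments. -/
lemma sort_eq_self_of_mem (hd : d ∈ monotoneCone n) (k : Fin n) : Tuple.sort d k = k := by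
  rw [Tuple.sort_eq_refl_iff_monotone.2 hd.2]
  rfl

lemma spacing_eq_increment (hd : d ∈ monotoneCone n) (k : Fin n) :
    spacing d k = increment k d := by
  rw [spacing, increment_apply, sort_eq_self_of_mem hd]
  split_ifs
  · rfl
  · rw [sort_eq_self_of_mem hd]

lemma upperSet_eq_Ici (hd : d ∈ monotoneCone n) (k : Fin n) : upperSet d k = Set.Ici k := by
  ext j
  simp [upperSet, sort_eq_self_of_mem hd]

lemma sum_increment (d : EuclideanSpace ℝ (Fin n)) (k : Fin n) :
    ∑ j, (if j ≤ k then increment j d else 0) = d k := by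
  simp_rw [increment_eq_cons_sub]
  rw [← Finset.sum_filter, sum_Iic_succ_sub_castSucc, Fin.cons_succ, Fin.cons_zero, sub_zero]

lemma sum_increment_min (hd : d ∈ monotoneCone n) (k l : Fin n) :
    ∑ j, (if j ≤ k ∧ j ≤ l then increment j d else 0) = min (d k) (d l) := by
  simp_rw [← le_min_iff]
  rw [sum_increment]
  rcases le_total k l with h | h
  · rw [min_eq_left h, min_eq_left (hd.2 h)]
  · rw [min_eq_right h, min_eq_right (hd.2 h)]

/-- Summation by parts: coordinate `k` occurs in the projections with `j ≤ k`, whose increments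
telescope to `d_k`. -/
lemma inner_diamondVec (d μ θ : EuclideanSpace ℝ (Fin n)) :
    inner ℝ (diamondVec d μ) θ = ∑ j, increment j d * inner ℝ μ (proj (Set.Ici j) θ) := by
  have h : ∀ j, increment j d * inner ℝ μ (proj (Set.Ici j) θ)
      = ∑ k, (if j ≤ k then increment j d else 0) * (μ k * θ k) := fun j => by
    rw [PiLp.inner_apply, Finset.mul_sum]
    refine Finset.sum_congr rfl fun k _ => ?_
    simp only [proj, Set.indicator_apply, Set.mem_Ici]
    split_ifs
    · simp [mul_comm (θ k)]
    · simp
  simp_rw [h]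
  rw [Finset.sum_comm]
  simp_rw [← Finset.sum_mul, sum_increment]
  rw [PiLp.inner_apply]
  refine Finset.sum_congr rfl fun k _ => ?_
  simp [diamondVec]
  ring

/-- The pair `(k, l)` occurs for `j ≤ min k l`; monotonicity makes the telescoped value `min (d k)
(d l)`. -/
lemma sum_diamondMat (hd : d ∈ monotoneCone n) (C : Matrix (Fin n) (Fin n) ℝ)
    (θ : EuclideanSpace ℝ (Fin n)) :
    ∑ k, ∑ l, θ k * diamondMat d C k l * θ l
      = ∑ j, increment j d *
        ∑ k, ∑ l, proj (Set.Ici j) θ k * C k l * proj (Set.Ici j) θ l := by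
  have h : ∀ j, increment j d *
        ∑ k, ∑ l, proj (Set.Ici j) θ k * C k l * proj (Set.Ici j) θ l
      = ∑ k, ∑ l, (if j ≤ k ∧ j ≤ l then increment j d else 0) * (θ k * C k l * θ l) := fun j => by
    rw [Finset.mul_sum]
    refine Finset.sum_congr rfl fun k _ => ?_
    rw [Finset.mul_sum]
    refine Finset.sum_congr rfl fun l _ => ?_
    simp only [proj, Set.indicator_apply, Set.mem_Ici]
    by_cases hk : j ≤ k <;> by_cases hl : j ≤ l <;> simp [hk, hl]
  simp_rw [h]
  symm
  rw [Finset.sum_comm]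
  refine Finset.sum_congr rfl fun k _ => ?_
  rw [Finset.sum_comm]
  refine Finset.sum_congr rfl fun l _ => ?_
  rw [← Finset.sum_mul, sum_increment_min hd, diamondMat, Matrix.of_apply]
  ring

/-- The term of index zero may be added: its projection is the identity, and the truncation kills it
off the ball. -/
lemma compensation_eq_sum (hd : d ∈ monotoneCone n) (ν : Measure (EuclideanSpace ℝ (Fin n))) :
    compensation d ν = ∑ j, increment j d • ∫ x in (Metric.closedBall 0 1)ᶜ,
      (Metric.closedBall 0 1).indicator (fun y => y) (proj (Set.Ici j) x) ∂ν := by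
  unfold compensation
  rw [Finset.sum_filter]
  refine Finset.sum_congr rfl fun j _ => ?_
  rw [spacing_eq_increment hd, upperSet_eq_Ici hd]
  split_ifs with h
  · rfl
  · rw [not_not] at h
    have hproj : ∀ x : EuclideanSpace ℝ (Fin n), proj (Set.Ici j) x = x := fun x => by
      have : Set.Ici j = Set.univ := Set.eq_univ_of_forall fun k => Fin.mk_le_of_le_val (by omega)
      rw [this]
      simp [proj]
    rw [setIntegral_eq_zero_of_forall_eq_zero, smul_zero]
    intro x hx
    rw [hproj, Set.indicator_of_notMem hx]

lemma integral_levyIntegrand_diamondMeasure (hd : d ∈ monotoneCone n)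
    {ν : Measure (EuclideanSpace ℝ (Fin n))} (hν : IsLevyMeasure ν)
    (θ : EuclideanSpace ℝ (Fin n)) :
    ∫ x, levyIntegrand θ x ∂diamondMeasure d ν
      = ∑ j, (increment j d : ℂ) * ∫ x, levyIntegrand θ (proj (Set.Ici j) x) ∂ν := by
  unfold diamondMeasure
  rw [integral_finsetSum_measure fun j _ =>
    (integrable_levyIntegrand_projMeasure hν.integrable_min _ θ).smul_measure ENNReal.ofReal_ne_top]
  refine Finset.sum_congr rfl fun j _ => ?_
  rw [integral_smul_measure, integral_levyIntegrand_projMeasure, spacing_eq_increment hd,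
    upperSet_eq_Ici hd, ENNReal.toReal_ofReal (increment_nonneg hd j), Complex.real_smul]

/-- For ordered `d`, the triplet `(c(d, ν) + d ⋄ μ, d ⋄ C, d ⋄ ν)` has the Lévy exponent
`∑ⱼ Δdⱼ Ψ(π_{j, …, n} θ)`. -/
theorem levyExponent_diamond (hd : d ∈ monotoneCone n) {ν : Measure (EuclideanSpace ℝ (Fin n))}
    (hν : IsLevyMeasure ν) (μ : EuclideanSpace ℝ (Fin n)) (C : Matrix (Fin n) (Fin n) ℝ)
    (θ : EuclideanSpace ℝ (Fin n)) :
    levyExponent (compensation d ν + diamondVec d μ) (diamondMat d C) (diamondMeasure d ν) θ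
      = diamondExponent μ C ν θ d := by
  -- The truncation is moved from `x` to its projection; the corrections add up to `c(d, ν)`.
  have h1 : ∀ j : Fin n, levyExponent μ C ν (proj (Set.Ici j) θ)
      = Complex.I * ((inner ℝ μ (proj (Set.Ici j) θ) : ℝ) : ℂ)
        - (1 / 2) * ((∑ k, ∑ l, proj (Set.Ici j) θ k * C k l * proj (Set.Ici j) θ l : ℝ) : ℂ)
        + (∫ x, levyIntegrand θ (proj (Set.Ici j) x) ∂ν
        + Complex.I * ((inner ℝ θ (∫ x in (Metric.closedBall 0 1)ᶜ,
          (Metric.closedBall 0 1).indicator (fun y => y) (proj (Set.Ici j) x) ∂ν) : ℝ) : ℂ)) :=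
    fun j => by
      rw [← integral_levyIntegrand_proj hν]
      rfl
  have h2 : levyExponent (compensation d ν + diamondVec d μ) (diamondMat d C)
      (diamondMeasure d ν) θ
      = Complex.I * ((inner ℝ (compensation d ν + diamondVec d μ) θ : ℝ) : ℂ)
        - (1 / 2) * ((∑ k, ∑ l, θ k * diamondMat d C k l * θ l : ℝ) : ℂ)
        + ∫ x, levyIntegrand θ x ∂diamondMeasure d ν := rfl
  rw [h2, diamondExponent_apply, integral_levyIntegrand_diamondMeasure hd hν, sum_diamondMat hd,
    inner_add_left, inner_diamondVec, compensation_eq_sum hd, sum_inner]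
  simp_rw [h1]
  push_cast
  simp only [mul_add, mul_sub, Finset.sum_add_distrib, Finset.sum_sub_distrib, Finset.mul_sum,
    real_inner_smul_left, Complex.ofReal_mul]
  simp_rw [fun j : Fin n => real_inner_comm θ (∫ x in (Metric.closedBall 0 1)ᶜ,
    (Metric.closedBall 0 1).indicator (fun y => y) (proj (Set.Ici j) x) ∂ν)]
  simp only [mul_left_comm, mul_comm, mul_assoc]
  ring

end Drift

/-! ### The space of doubled dimension -/

section Pair

variable {ι : Type*} [Fintype ι]

lemma inner_pair (a b x y : EuclideanSpace ℝ ι) :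
    inner ℝ (pair a b) (pair x y) = inner ℝ a x + inner ℝ b y := by
  simp [pair, PiLp.inner_apply, Fintype.sum_sum_type]

lemma norm_pair_zero (x : EuclideanSpace ℝ ι) : ‖pair 0 x‖ = ‖x‖ := by
  rw [EuclideanSpace.norm_eq, EuclideanSpace.norm_eq]
  simp [pair, Fintype.sum_sum_type]

lemma exists_eq_pair (θ : EuclideanSpace ℝ (ι ⊕ ι)) : ∃ θ₁ θ₂, θ = pair θ₁ θ₂ := by
  refine ⟨WithLp.toLp 2 fun k => θ (Sum.inl k), WithLp.toLp 2 fun k => θ (Sum.inr k), ?_⟩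
  ext k
  cases k <;> rfl

lemma continuous_pair :
    Continuous fun p : EuclideanSpace ℝ ι × EuclideanSpace ℝ ι => pair p.1 p.2 := by
  refine (PiLp.continuous_toLp 2 _).comp (continuous_pi fun k => ?_)
  cases k <;> simp only [Sum.elim_inl, Sum.elim_inr] <;> fun_prop

lemma imInner_pair (a b x y : EuclideanSpace ℝ ι) :
    imInner (pair a b) (pair x y) = imInner a x + imInner b y := by
  simp only [imInner_apply, inner_pair]
  push_cast
  ring

/-- The embedding `x ↦ (0, x)` is isometric, so both truncations agree. -/
lemma levyIntegrand_pair_zero (θ₁ θ₂ x : EuclideanSpace ℝ ι) :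
    levyIntegrand (pair θ₁ θ₂) (pair 0 x) = levyIntegrand θ₂ x := by
  have h : pair 0 x ∈ Metric.closedBall (0 : EuclideanSpace ℝ (ι ⊕ ι)) 1
      ↔ x ∈ Metric.closedBall (0 : EuclideanSpace ℝ ι) 1 := by
    rw [mem_closedBall_zero_iff, mem_closedBall_zero_iff, norm_pair_zero]
  unfold levyIntegrand
  by_cases hx : x ∈ Metric.closedBall (0 : EuclideanSpace ℝ ι) 1
  · rw [Set.indicator_of_mem hx, Set.indicator_of_mem (h.2 hx), inner_pair, inner_zero_right,
      zero_add]
  · rw [Set.indicator_of_notMem hx, Set.indicator_of_notMem fun h' => hx (h.1 h'), inner_pair,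
      inner_zero_right, zero_add]

lemma norm_le_norm_pair_right (x y : EuclideanSpace ℝ ι) : ‖y‖ ≤ ‖pair x y‖ := by
  rw [EuclideanSpace.norm_eq, EuclideanSpace.norm_eq]
  refine Real.sqrt_le_sqrt ?_
  simp only [pair, Fintype.sum_sum_type, Sum.elim_inl, Sum.elim_inr]
  exact le_add_of_nonneg_left (Finset.sum_nonneg fun i _ => sq_nonneg _)

lemma quadratic_form_weakCov {n : ℕ} (C : Matrix (Fin n) (Fin n) ℝ)
    (d θ₁ θ₂ : EuclideanSpace ℝ (Fin n)) :
    ∑ k, ∑ l, pair θ₁ θ₂ k * weakCov C d k l * pair θ₁ θ₂ l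
      = ∑ k, ∑ l, θ₂ k * diamondMat d C k l * θ₂ l := by
  simp [weakCov, pair, Fintype.sum_sum_type]

lemma integrable_of_forall_inner {α : Type*} [MeasurableSpace α] {ρ : Measure α}
    {V : α → EuclideanSpace ℝ ι} (h : ∀ θ, Integrable (fun a => inner ℝ θ (V a)) ρ) :
    Integrable V ρ := by
  classical
  refine Integrable.of_eval_piLp fun i => ?_
  simpa [EuclideanSpace.inner_single_left] using h (EuclideanSpace.single i 1)

end Pair

/-! ### The exponent of the weakly subordinated process -/

section Jumps

variable {n : ℕ} {Ω : Type*} [MeasurableSpace Ω] {P : Measure Ω} [IsProbabilityMeasure P]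
  {X T : ℝ≥0 → Ω → EuclideanSpace ℝ (Fin n)} {μ : EuclideanSpace ℝ (Fin n)}
  {C : Matrix (Fin n) (Fin n) ℝ} {ν : Measure (EuclideanSpace ℝ (Fin n))}
  {d : EuclideanSpace ℝ (Fin n)} {τ : Measure (EuclideanSpace ℝ (Fin n))}

/-- This makes the laws of `(s, X(s))` a kernel. They are unchanged by passing to the jointly
measurable version. -/
lemma measurable_map_pair_evalAt (hX : IsLevyProcess X P) :
    Measurable fun s => P.map (fun ω => pair s (evalAt X s ω)) := by
  obtain ⟨Y, hY, hXY⟩ := exists_measurable_evalAt hX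
  have h1 : (fun s => P.map (fun ω => pair s (evalAt X s ω)))
      = fun s => P.map (fun ω => pair s (Y s ω)) := by
    ext1 s
    refine Measure.map_congr ?_
    filter_upwards [hXY] with ω hω
    rw [hω]
  have h2 : Measurable fun p : EuclideanSpace ℝ (Fin n) × Ω => pair p.1 (Y p.1 p.2) :=
    continuous_pair.measurable.comp (measurable_fst.prodMk hY)
  rw [h1]
  refine Measure.measurable_of_measurable_coe _ fun B hB => ?_
  have h3 : ∀ s, P.map (fun ω => pair s (Y s ω)) B
      = P (Prod.mk s ⁻¹' ((fun p : EuclideanSpace ℝ (Fin n) × Ω => pair p.1 (Y p.1 p.2)) ⁻¹' B)) :=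
    fun s => Measure.map_apply (h2.comp measurable_prodMk_left) hB
  simp_rw [h3]
  exact measurable_measure_prodMk_left (h2 hB)

/-- The truncated mean of `(s, X(s))` in a direction. -/
lemma integral_levyIntegrand_pair (hX : HasTriplet X P μ C ν) {s : EuclideanSpace ℝ (Fin n)}
    (hs : s ∈ monotoneCone n) (θ₁ θ₂ : EuclideanSpace ℝ (Fin n)) :
    ∫ z, levyIntegrand (pair θ₁ θ₂) z ∂P.map (fun ω => pair s (evalAt X s ω))
      = Complex.exp ((imInner θ₁ + diamondExponent μ C ν θ₂) s) - 1
        - Complex.I * ((inner ℝ θ₁ (P.real {ω | pair s (evalAt X s ω) ∈ Metric.closedBall 0 1} • s)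
          + inner ℝ θ₂ (∫ ω in {ω | pair s (evalAt X s ω) ∈ Metric.closedBall 0 1},
            evalAt X s ω ∂P) : ℝ) : ℂ) := by
  have hev := measurable_evalAt hX.isLevyProcess.measurable s
  have hpair : Measurable fun ω => pair s (evalAt X s ω) :=
    continuous_pair.measurable.comp (measurable_const.prodMk hev)
  set A : Set Ω := {ω | pair s (evalAt X s ω) ∈ Metric.closedBall 0 1}
  have hA : MeasurableSet A := hpair measurableSet_closedBall
  -- On `A` the norm of `X(s)` is at most one, so no moments are needed.
  have hintX : IntegrableOn (fun ω => evalAt X s ω) A P := by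
    refine ⟨hev.aestronglyMeasurable, HasFiniteIntegral.of_bounded (C := 1) ?_⟩
    refine (ae_restrict_iff' hA).2 (Eventually.of_forall fun ω hω => ?_)
    exact (norm_le_norm_pair_right s _).trans (mem_closedBall_zero_iff.1 hω)
  have hind : ∀ ω, (Metric.closedBall (0 : EuclideanSpace ℝ (Fin n ⊕ Fin n)) 1).indicator
      (fun y => inner ℝ (pair θ₁ θ₂) y) (pair s (evalAt X s ω))
      = A.indicator (fun ω => inner ℝ θ₁ s + inner ℝ θ₂ (evalAt X s ω)) ω := fun ω => by
    by_cases hω : ω ∈ A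
    · exact (Set.indicator_of_mem (show pair s (evalAt X s ω) ∈ _ from hω) _).trans
        ((inner_pair _ _ _ _).trans (Set.indicator_of_mem hω
          (fun ω => inner ℝ θ₁ s + inner ℝ θ₂ (evalAt X s ω))).symm)
    · exact (Set.indicator_of_notMem (show pair s (evalAt X s ω) ∉ _ from hω) _).trans
        (Set.indicator_of_notMem hω _).symm
  have hintA : IntegrableOn (fun ω => inner ℝ θ₁ s + inner ℝ θ₂ (evalAt X s ω)) A P :=
    (integrable_const _).add (Integrable.const_inner (𝕜 := ℝ) θ₂ hintX)
  have hintA' : Integrable (fun ω => ((A.indicator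
      (fun ω => inner ℝ θ₁ s + inner ℝ θ₂ (evalAt X s ω)) ω : ℝ) : ℂ)) P :=
    Integrable.ofReal ((integrable_indicator_iff hA).2 hintA)
  have hexp : Integrable (fun ω => Complex.exp (imInner (pair θ₁ θ₂) (pair s (evalAt X s ω)))) P :=
    (integrable_const (1 : ℝ)).mono'
      (Complex.measurable_exp.comp ((imInner _).measurable.comp hpair)).aestronglyMeasurable
      (Eventually.of_forall fun ω => (norm_exp_imInner _ _).le)
  have hexp1 : Integrable (fun ω =>
      Complex.exp (imInner (pair θ₁ θ₂) (pair s (evalAt X s ω))) - 1) P :=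
    hexp.sub (integrable_const 1)
  rw [integral_map hpair.aemeasurable (measurable_levyIntegrand _).aestronglyMeasurable]
  unfold levyIntegrand
  simp_rw [hind, ← imInner_apply]
  rw [integral_sub hexp1 (hintA'.const_mul _),
    integral_sub hexp (integrable_const 1), integral_const_mul, integral_complex_ofReal,
    integral_indicator hA, integral_add (integrable_const _)
      (Integrable.const_inner (𝕜 := ℝ) θ₂ hintX), integral_inner hintX]
  simp_rw [imInner_pair, Complex.exp_add]
  rw [integral_const_mul, integral_exp_imInner_evalAt hX hs, ← Complex.exp_add]
  simp [real_inner_smul_right]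

/-- The Lévy exponent of the weakly subordinated process. -/
theorem levyExponent_weakSubordination (hX : HasTriplet X P μ C ν) (hT : IsSubordinator T P d τ)
    (hmono : ∀ᵐ ω ∂P, ∀ t, Monotone (fun k : Fin n => T t ω k))
    (hZ : IsLevyMeasure (weakLevyMeasure X P ν d τ)) (θ₁ θ₂ : EuclideanSpace ℝ (Fin n)) :
    levyExponent (pair (weakLoc₁ X P d τ) (weakLoc₂ X P μ ν d τ)) (weakCov C d)
        (weakLevyMeasure X P ν d τ) (pair θ₁ θ₂)
      = cumulant d τ (imInner θ₁ + diamondExponent μ C ν θ₂) := by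
  have hd := hT.drift_mem_monotoneCone hmono
  have hτK := hT.levyMeasure_ae_mem_monotoneCone hmono
  have hτ := integrable_min_of_isFiniteVariation hT.isFiniteVariation
  have hrestrict := hT.restrict_puncturedOrthant hmono
  have hexp : ∀ θ₁ θ₂ : EuclideanSpace ℝ (Fin n), Integrable (fun s =>
      Complex.exp ((imInner θ₁ + diamondExponent μ C ν θ₂) s) - 1) τ := fun θ₁ θ₂ => by
    refine integrable_exp_sub_one hτ (hτK.mono fun s hs => ?_)
    rw [add_apply, Complex.add_re, imInner_re, zero_add]
    exact diamondExponent_re_nonpos hX hs θ₂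
  set κ : Kernel (EuclideanSpace ℝ (Fin n)) (EuclideanSpace ℝ (Fin n ⊕ Fin n)) :=
    ⟨fun s => P.map (fun ω => pair s (evalAt X s ω)),
      measurable_map_pair_evalAt hX.isLevyProcess⟩
  have hZeq : weakLevyMeasure X P ν d τ
      = (diamondMeasure d ν).map (fun x => pair 0 x) + τ.bind κ := by
    rw [weakLevyMeasure, hrestrict]
    rfl
  have hcomp : τ.bind κ = (κ ∘ₖ Kernel.const Unit τ) () := Measure.comp_eq_comp_const_apply
  have hbind : ∀ θ, Integrable (levyIntegrand θ) (τ.bind κ) := fun θ => by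
    refine integrable_levyIntegrand (hZ.integrable_min.mono_measure ?_) θ
    rw [hZeq]
    exact Measure.le_add_left le_rfl
  have hjump : ∀ θ, Integrable (fun s => ∫ z, levyIntegrand θ z ∂κ s) τ := fun θ => by
    have h := hbind θ
    rw [hcomp] at h
    simpa using h.integral_comp
  set V₁ : EuclideanSpace ℝ (Fin n) → EuclideanSpace ℝ (Fin n) := fun s =>
    P.real {ω | pair s (evalAt X s ω) ∈ Metric.closedBall 0 1} • s
  set V₂ : EuclideanSpace ℝ (Fin n) → EuclideanSpace ℝ (Fin n) := fun s =>
    ∫ ω in {ω | pair s (evalAt X s ω) ∈ Metric.closedBall 0 1}, evalAt X s ω ∂P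
  have hκV : ∀ θ₁ θ₂, ∀ᵐ s ∂τ, ∫ z, levyIntegrand (pair θ₁ θ₂) z ∂κ s
      = Complex.exp ((imInner θ₁ + diamondExponent μ C ν θ₂) s) - 1
        - Complex.I * ((inner ℝ θ₁ (V₁ s) + inner ℝ θ₂ (V₂ s) : ℝ) : ℂ) := fun θ₁ θ₂ =>
    hτK.mono fun s hs => integral_levyIntegrand_pair hX hs θ₁ θ₂
  -- The truncated means are, up to sign and the factor `i`, the difference between the kernel
  -- integral of the Lévy integrand and `exp Λ - 1`. Both are `τ`-integrable, the former because the
  -- weak Lévy measure is a Lévy measure.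
  have hV : ∀ θ₁ θ₂, Integrable (fun s => inner ℝ θ₁ (V₁ s) + inner ℝ θ₂ (V₂ s)) τ :=
    fun θ₁ θ₂ => by
      have h := ((hexp θ₁ θ₂).sub (hjump (pair θ₁ θ₂))).im
      refine h.congr ?_
      filter_upwards [hκV θ₁ θ₂] with s hs
      rw [Pi.sub_apply, hs]
      simp
  have hV1 : Integrable V₁ τ := integrable_of_forall_inner fun θ => by simpa using hV θ 0
  have hV2 : Integrable V₂ τ := integrable_of_forall_inner fun θ => by simpa using hV 0 θ
  have hpair0 : Measurable fun x : EuclideanSpace ℝ (Fin n) => pair 0 x :=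
    continuous_pair.measurable.comp (measurable_const.prodMk measurable_id)
  have hdrift : Integrable (levyIntegrand (pair θ₁ θ₂))
      ((diamondMeasure d ν).map (fun x => pair 0 x)) := by
    refine integrable_levyIntegrand (hZ.integrable_min.mono_measure ?_) _
    rw [hZeq]
    exact Measure.le_add_right le_rfl
  have hint1 : ∫ z, levyIntegrand (pair θ₁ θ₂) z ∂(diamondMeasure d ν).map (fun x => pair 0 x)
      = ∫ x, levyIntegrand θ₂ x ∂diamondMeasure d ν := by
    rw [integral_map hpair0.aemeasurable (measurable_levyIntegrand _).aestronglyMeasurable]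
    simp_rw [levyIntegrand_pair_zero]
  -- The subtracted terms are the truncated means that `m₁` and `m₂` add back.
  have hint2 : ∫ z, levyIntegrand (pair θ₁ θ₂) z ∂τ.bind κ
      = ∫ s, (Complex.exp ((imInner θ₁ + diamondExponent μ C ν θ₂) s) - 1) ∂τ
        - Complex.I * ((inner ℝ θ₁ (∫ s, V₁ s ∂τ) + inner ℝ θ₂ (∫ s, V₂ s ∂τ) : ℝ) : ℂ) := by
    have h := hbind (pair θ₁ θ₂)
    have hVc : Integrable (fun s => ((inner ℝ θ₁ (V₁ s) + inner ℝ θ₂ (V₂ s) : ℝ) : ℂ)) τ :=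
      (hV θ₁ θ₂).ofReal
    rw [hcomp] at h ⊢
    rw [Kernel.integral_comp h, Kernel.const_apply, integral_congr_ae (hκV θ₁ θ₂),
      integral_sub (hexp θ₁ θ₂) (hVc.const_mul _), integral_const_mul,
      ← integral_inner hV1, ← integral_inner hV2,
      ← integral_add (hV1.const_inner θ₁) (hV2.const_inner θ₂), ← integral_complex_ofReal]
  have hsplit : levyExponent (pair (weakLoc₁ X P d τ) (weakLoc₂ X P μ ν d τ)) (weakCov C d)
        (weakLevyMeasure X P ν d τ) (pair θ₁ θ₂)
      = Complex.I * ((inner ℝ (pair (weakLoc₁ X P d τ) (weakLoc₂ X P μ ν d τ)) (pair θ₁ θ₂) : ℝ) : ℂ)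
        - (1 / 2) * ((∑ k, ∑ l, pair θ₁ θ₂ k * weakCov C d k l * pair θ₁ θ₂ l : ℝ) : ℂ)
        + ∫ z, levyIntegrand (pair θ₁ θ₂) z ∂weakLevyMeasure X P ν d τ := rfl
  have hdiamond : diamondExponent μ C ν θ₂ d
      = Complex.I * ((inner ℝ (compensation d ν + diamondVec d μ) θ₂ : ℝ) : ℂ)
        - (1 / 2) * ((∑ k, ∑ l, θ₂ k * diamondMat d C k l * θ₂ l : ℝ) : ℂ)
        + ∫ x, levyIntegrand θ₂ x ∂diamondMeasure d ν :=
    (levyExponent_diamond hd hX.isLevyMeasure μ C θ₂).symm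
  have hloc₁ : weakLoc₁ X P d τ = d + ∫ s, V₁ s ∂τ := by rw [weakLoc₁, hrestrict]
  have hloc₂ : weakLoc₂ X P μ ν d τ = compensation d ν + diamondVec d μ + ∫ s, V₂ s ∂τ := by
    rw [weakLoc₂, hrestrict]
  rw [hsplit, hZeq, integral_add_measure hdrift (hbind _), hint1, hint2, quadratic_form_weakCov,
    cumulant, add_apply, hdiamond, imInner_apply, inner_pair, hloc₁, hloc₂, inner_add_left,
    inner_add_left (compensation d ν + diamondVec d μ), real_inner_comm θ₁ d,
    real_inner_comm θ₁ (∫ s, V₁ s ∂τ), real_inner_comm θ₂ (∫ s, V₂ s ∂τ)]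
  push_cast
  ring

end Jumps

end WeakSubordination

end

/-! ### Equality in law via characteristic functions -/

theorem proposition3p4 {n : ℕ} {Ω Ω' : Type*} [MeasurableSpace Ω] [MeasurableSpace Ω']
    (P : Measure Ω) [IsProbabilityMeasure P] (P' : Measure Ω') [IsProbabilityMeasure P']
    (X T : ℝ≥0 → Ω → EuclideanSpace ℝ (Fin n))
    (Z : ℝ≥0 → Ω' → EuclideanSpace ℝ (Fin n ⊕ Fin n))
    (μ : EuclideanSpace ℝ (Fin n)) (C : Matrix (Fin n) (Fin n) ℝ)
    (ν : Measure (EuclideanSpace ℝ (Fin n)))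
    (d : EuclideanSpace ℝ (Fin n)) (τ : Measure (EuclideanSpace ℝ (Fin n)))
    (hX : WeakSubordination.HasTriplet X P μ C ν)
    (hT : WeakSubordination.IsSubordinator T P d τ)
    (hTX : IndepFun (fun ω (t : ℝ≥0) => T t ω) (fun ω (t : ℝ≥0) => X t ω) P)
    (hZ : WeakSubordination.IsWeakSubordination Z P' X P μ C ν d τ)
    (hmono : ∀ᵐ ω ∂P, ∀ t, Monotone (fun k : Fin n => T t ω k))
    (t : ℝ≥0) :
    IdentDistrib (Z t)
      (fun ω => WeakSubordination.pair (T t ω) (WeakSubordination.evalAt X (T t ω) ω)) P' P := by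
  open WeakSubordination in
  have hTm := hT.isLevyProcess.measurable t
  have hZm := hZ.isLevyProcess.measurable t
  -- Evaluation of `X` at the random time is handled through the jointly measurable version, with
  -- which it agrees almost surely at all times at once.
  have hpair : AEMeasurable (fun ω => pair (T t ω) (evalAt X (T t ω) ω)) P := by
    obtain ⟨Y, hY, hXY⟩ := exists_measurable_evalAt hX.isLevyProcess
    have hY' : Measurable fun ω => Y (T t ω) ω := hY.comp (hTm.prodMk measurable_id')
    refine ⟨fun ω => pair (T t ω) (Y (T t ω) ω),
      continuous_pair.measurable.comp (hTm.prodMk hY'), ?_⟩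
    filter_upwards [hXY] with ω hω
    rw [hω]
  refine ⟨hZm.aemeasurable, hpair, ?_⟩
  have := Measure.isProbabilityMeasure_map (μ := P') hZm.aemeasurable
  have := Measure.isProbabilityMeasure_map (μ := P) hpair
  refine Measure.ext_of_charFun (funext fun θ => ?_)
  obtain ⟨θ₁, θ₂, rfl⟩ := exists_eq_pair θ
  rw [hZ.charFun_eq, levyExponent_weakSubordination hX hT hmono hZ.isLevyMeasure,
    charFun_eq_integral_imInner, integral_map hpair (by fun_prop)]
  simp_rw [imInner_pair]
  rw [integral_exp_subordinated hX hT hTX hmono]
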